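/- **Setting.** For $u\ge 2$ and $n\ge1$ put $L=\lceil\log_2 u\rceil$ and $\tau=nL$. Let $w\in(0,1]^u$. For hash functions $h:\{1,\dots,u\}\to\{1,\dots,n\}$ and $s:\{1,\dots,u\}\to[0,1]$, the *KOR sketch* $H=H(w,h,s)$ is the $\tau\times u$ matrix over $\mathrm{GF}(2)$ obtained by stacking $H_0,\dots,H_{L-1}$, where $H_i$ is $n\times u$ and $(H_i)_{k,j}=1$ if $h(j)=k$ and $s(j)\in(w_j/2^{i+1},w_j/2^i]$, and $(H_i)_{k,j}=0$ otherwise. Let $\mathcal H$ be the distribution of $H$ when $h$ and $s$ are independent and fully random (uniform among all functions; the values of $s$ are independent and uniform on $[0,1]$), and let $\mathcal N_\varepsilon$ be the distribution on $\{0,1\}^\tau$ of a vector of independent entries, each equal to $1$ with probability $p=1/(2+\varepsilon)$. Vectors $x\in\{0,1\}^u$ are *neighbouring* if they differ in exactly one entry; a mechanism $\mathcal M$ is *$\varepsilon$-differentially private* if $\Pr[\mathcal M(x)\in W]\le e^{\varepsilon}\Pr[\mathcal M(x')\in W]$ for all neighbouring $x,x'$ and all sets $W$ of outputs. Write $\|x\|_0$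 for the number of non-zero entries of $x$, and $\|x\circ w\|_1=\sum_j x_jw_j$. Running times are worst-case numbers of steps of a unit-cost random access machine with natural-number cells (addition, truncated subtraction, comparison, indirect addressing) and real-number cells (field operations, $\ln$, comparison), which can draw a uniform number from $[0,1]$ in one step. **Theorem (Noisy KOR sketch).** For every $E>0$ there are a constant $C>0$ and two programs $P,Q$ such that for all $u\ge2$, $0<\varepsilon\le E$ and $0<\beta<1$ there is $n\ge1$ with $$\tau=n\lceil\log_2u\rceil\le C\,\log^2(u)\,\varepsilon^{-2}\beta^{-2}$$ and with the following two properties. 1. Given a vector $y\in\{0,1\}^\tau$ and the numbers $u,L,n,\varepsilon,\beta$, the program $P$ (deterministically) computes within $C\tau$ steps a real number $\hat w(y)$ such that for every $w\in(0,1]^u$ and every $x\in\{0,1\}^u$, for independent $H\sim\mathcal H$ and $\varphi\sim\mathcal N_\varepsilon$, with probability at least $1-1/u$, $$\bigl|\hat w(Hx+\varphi)-\|x\circ w\|_1\bigr|<\beta\,\|x\circ w\|_1+C\log(u)\,\varepsilon^{-2}\beta^{-2}.$$ 2. For every $w\in(0,1]^u$ and all hash functions $h,s$ (in particular for every $H=H(w,h,s)$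 in the support of $\mathcal H$), the mechanism $x\mapsto Hx+\varphi$ is $\varepsilon$-differentially private over the choice of $\varphi\sim\mathcal N_\varepsilon$. Moreover, for every $x\in\{0,1\}^u$, given a list of the non-zero positions of $x$ in any order, the numbers $u,L,n,\|x\|_0,\varepsilon,\beta$, and unit-cost access to the values of $h$, $s$ and $w$, the program $Q$ outputs within $C(\|x\|_0\log u+\tau)$ steps, including the time for sampling the noise, a vector whose distribution is that of $Hx+\varphi$, $\varphi\sim\mathcal N_\varepsilon$. -/

import Mathlib

open MeasureTheory ProbabilityTheory

namespace NoisyKOR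

/-! ### Machine model

A unit-cost random access machine with two unbounded memories: cells holding natural numbers
(addition, truncated subtraction, comparison, indirect addressing) and cells holding real numbers
(field operations, `log`, comparison).  There is no conversion of reals into naturals.
Every instruction costs one step.  The machine has read-only random access to input arrays;
hash functions that can be evaluated in constant time are presented to it as such arrays.
The instruction `rand` draws a fresh uniform number from `[0,1]`. -/

/-- Instructions; `N[a]` denotes a natural cell and `R[a]` a real cell. -/
inductive Instr where
  /-- `N[a] := c` -/
  | const (a c : ℕ)
  /-- `N[a] := N[b] + N[c]` -/
  | add (a b c : ℕ)
  /-- `N[a] := N[b] - N[c]` (truncated) -/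
  | sub (a b c : ℕ)
  /-- `N[a] := N[N[b]]` -/
  | load (a b : ℕ)
  /-- `N[N[a]] := N[b]` -/
  | store (a b : ℕ)
  /-- `N[a] :=` entry `N[b]` of the `k`-th natural input array -/
  | query (a k b : ℕ)
  /-- `R[a] := c` -/
  | rconst (a c : ℕ)
  /-- `R[a] := R[b] + R[c]` -/
  | radd (a b c : ℕ)
  /-- `R[a] := R[b] - R[c]` -/
  | rsub (a b c : ℕ)
  /-- `R[a] := R[b] * R[c]` -/
  | rmul (a b c : ℕ)
  /-- `R[a] := R[b] / R[c]` -/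
  | rdiv (a b c : ℕ)
  /-- `R[a] := log R[b]` -/
  | rlog (a b : ℕ)
  /-- `R[a] := R[N[b]]` -/
  | rload (a b : ℕ)
  /-- `R[N[a]] := R[b]` -/
  | rstore (a b : ℕ)
  /-- `R[a] :=` entry `N[b]` of the `k`-th real input array -/
  | rquery (a k b : ℕ)
  /-- `R[a] :=` the next random number -/
  | rand (a : ℕ)
  /-- write `N[b]` to position `N[a]` of the output array -/
  | write (a b : ℕ)
  /-- jump to instruction `l` if `N[a] ≤ N[b]` -/
  | jle (a b l : ℕ)
  /-- jump to instruction `l` if `R[a] ≤ R[b]` -/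
  | rjle (a b l : ℕ)

/-- A program is a finite list of instructions; it halts when the program counter leaves it. -/
abbrev Program := List Instr

/-- The read-only inputs: natural arrays, real arrays, and the stream of random numbers. -/
structure Env where
  natIn : ℕ → ℕ → ℕ
  realIn : ℕ → ℕ → ℝ
  coins : ℕ → ℝ

/-- Machine configurations: program counter, the two memories, the output array, and the number
of random numbers drawn so far. -/
structure Config where
  pc : ℕ
  N : ℕ → ℕ
  R : ℕ → ℝ
  out : ℕ → ℕ
  drawn : ℕ

open Classical in
/-- The effect of one instruction. -/
noncomputable def exec (e : Env) (c : Config) : Instr → Config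
  | .const a v => { c with pc := c.pc + 1, N := Function.update c.N a v }
  | .add a b d => { c with pc := c.pc + 1, N := Function.update c.N a (c.N b + c.N d) }
  | .sub a b d => { c with pc := c.pc + 1, N := Function.update c.N a (c.N b - c.N d) }
  | .load a b => { c with pc := c.pc + 1, N := Function.update c.N a (c.N (c.N b)) }
  | .store a b => { c with pc := c.pc + 1, N := Function.update c.N (c.N a) (c.N b) }
  | .query a k b => { c with pc := c.pc + 1, N := Function.update c.N a (e.natIn k (c.N b)) }
  | .rconst a v => { c with pc := c.pc + 1, R := Function.update c.R a (v : ℝ) }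
  | .radd a b d => { c with pc := c.pc + 1, R := Function.update c.R a (c.R b + c.R d) }
  | .rsub a b d => { c with pc := c.pc + 1, R := Function.update c.R a (c.R b - c.R d) }
  | .rmul a b d => { c with pc := c.pc + 1, R := Function.update c.R a (c.R b * c.R d) }
  | .rdiv a b d => { c with pc := c.pc + 1, R := Function.update c.R a (c.R b / c.R d) }
  | .rlog a b => { c with pc := c.pc + 1, R := Function.update c.R a (Real.log (c.R b)) }
  | .rload a b => { c with pc := c.pc + 1, R := Function.update c.R a (c.R (c.N b)) }
  | .rstore a b => { c with pc := c.pc + 1, R := Function.update c.R (c.N a) (c.R b) }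
  | .rquery a k b => { c with pc := c.pc + 1, R := Function.update c.R a (e.realIn k (c.N b)) }
  | .rand a =>
      { c with pc := c.pc + 1, R := Function.update c.R a (e.coins c.drawn), drawn := c.drawn + 1 }
  | .write a b => { c with pc := c.pc + 1, out := Function.update c.out (c.N a) (c.N b) }
  | .jle a b l => { c with pc := if c.N a ≤ c.N b then l else c.pc + 1 }
  | .rjle a b l => { c with pc := if c.R a ≤ c.R b then l else c.pc + 1 }

/-- One step of the machine; a halted configuration does not change. -/
noncomputable def step (P : Program) (e : Env) (c : Config) : Config :=
  match P[c.pc]? with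
  | some i => exec e c i
  | none => c

/-- `P`, started in `c₀`, halts in configuration `c` after at most `t` steps. -/
def HaltsWithin (P : Program) (e : Env) (c₀ : Config) (t : ℝ) (c : Config) : Prop :=
  ∃ k : ℕ, (k : ℝ) ≤ t ∧ (step P e)^[k] c₀ = c ∧ P.length ≤ c.pc

/-- Initial configuration: the given numbers stand in the first cells of the two memories,
all other cells are `0`. -/
def start (ns : List ℕ) (rs : List ℝ) : Config where
  pc := 0
  N := fun a => ns.getD a 0
  R := fun a => rs.getD a 0
  out := fun _ => 0
  drawn := 0

/-- A finite vector as an input array, padded with `0`. -/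
def toArray {α : Type} [Zero α] {m : ℕ} (f : Fin m → α) : ℕ → α :=
  fun a => if h : a < m then f ⟨a, h⟩ else 0

/-! ### The sketch -/

/-- The number of levels, `log₂ u` rounded up. -/
def levels (u : ℕ) : ℕ := Nat.clog 2 u

/-- The length `τ` of a sketch with `n` entries in each level. -/
abbrev sketchLen (u n : ℕ) : ℕ := levels u * n

instance {m k α : Type*} [MeasurableSpace α] : MeasurableSpace (Matrix m k α) :=
  inferInstanceAs (MeasurableSpace (m → k → α))

open Classical in
/-- The KOR sketch given by hash functions `h : U → [n]` and `s : U → [0,1]`: the stack of the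
matrices `H_i`, for the levels `i`, where `(H_i)_{k,j} = 1` if and only if `h j = k` and
`s j ∈ (w_j / 2^(i+1), w_j / 2^i]`.  Row `r = i * n + k` is row `k` of level `i`. -/
noncomputable def sketch {u n : ℕ} (w : Fin u → ℝ) (h : Fin u → Fin n) (s : Fin u → unitInterval) :
    Matrix (Fin (sketchLen u n)) (Fin u) (ZMod 2) :=
  fun r j =>
    if h j = r.modNat ∧
        (s j : ℝ) ∈ Set.Ioc (w j / 2 ^ ((r.divNat : ℕ) + 1)) (w j / 2 ^ (r.divNat : ℕ))
    then 1 else 0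

/-- The distribution of the sketch for independent, fully random hash functions `h` and `s`. -/
noncomputable def sketchDist {u : ℕ} (n : ℕ) (w : Fin u → ℝ) :
    Measure (Matrix (Fin (sketchLen u n)) (Fin u) (ZMod 2)) :=
  ((uniformOn (Set.univ : Set (Fin u → Fin n))).prod
    (Measure.pi fun _ : Fin u => (volume : Measure unitInterval))).map
      fun hs => sketch w hs.1 hs.2

/-- The noise distribution: `τ` independent entries, each equal to `1` with probability
`1 / (2 + ε)` and to `0` otherwise. -/
noncomputable def noiseDist (τ : ℕ) (ε : ℝ) : Measure (Fin τ → ZMod 2) :=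
  Measure.pi fun _ => bernoulliMeasure 1 0 (Set.projIcc 0 1 zero_le_one (1 / (2 + ε)))

/-- The law of an infinite sequence of independent uniform numbers from `[0,1]`. -/
noncomputable def coinDist : Measure (ℕ → unitInterval) :=
  Measure.infinitePi fun _ => (volume : Measure unitInterval)

/-- `‖x ∘ w‖₁`. -/
noncomputable def weight {u : ℕ} (w : Fin u → ℝ) (x : Fin u → ZMod 2) : ℝ :=
  ∑ j, |((x j).val : ℝ) * w j|

/-- Pure differential privacy of a mechanism with respect to a neighbouring relation. -/
def IsDP {X Y : Type*} [MeasurableSpace Y] (nbr : X → X → Prop) (ε : ℝ) (M : X → Measure Y) :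
    Prop :=
  ∀ x x', nbr x x' → ∀ W : Set Y, M x W ≤ ENNReal.ofReal (Real.exp ε) * M x' W

/-! ### The two algorithmic tasks -/

/-- On input a noisy sketch `y`, the numbers `u`, `levels u`, `n` and the parameters `ε`, `β`,
the program `P` halts within `t` steps with the real number `v` in the first real cell.
It uses no randomness. -/
def Estimates (P : Program) (u n : ℕ) (ε β : ℝ) (y : Fin (sketchLen u n) → ZMod 2)
    (t v : ℝ) : Prop :=
  ∃ c : Config,
    HaltsWithin P
      { natIn := fun k => if k = 0 then toArray fun r => (y r).val else fun _ => 0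
        realIn := fun _ _ => 0
        coins := fun _ => 0 }
      (start [u, levels u, n] [ε, β]) t c ∧
    c.R 0 = v

/-- On input a list `l` of positions (natural array `0`), with access to the hash functions `h`
(natural array `1`) and `s` (real array `1`), the weights `w` (real array `0`), the stream `ω` of
random numbers, the numbers `u`, `levels u`, `n`, the length of `l`, and the parameters `ε`, `β`,
the program `P` halts within `t` steps and has then written `y` to the output array. -/
def Sketches (P : Program) {u n : ℕ} (ε β : ℝ) (w : Fin u → ℝ) (h : Fin u → Fin n)
    (s : Fin u → unitInterval) (l : List (Fin u)) (ω : ℕ → unitInterval) (t : ℝ)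
    (y : Fin (sketchLen u n) → ZMod 2) : Prop :=
  ∃ c : Config,
    HaltsWithin P
      { natIn := fun k =>
          if k = 0 then toArray fun a => ((l.get a : Fin u) : ℕ)
          else if k = 1 then toArray fun j => (h j : ℕ)
          else fun _ => 0
        realIn := fun k =>
          if k = 0 then toArray w
          else if k = 1 then toArray fun j => (s j : ℝ)
          else fun _ => 0
        coins := fun a => (ω a : ℝ) }
      (start [u, levels u, n, l.length] [ε, β]) t c ∧
    ∀ r : Fin (sketchLen u n), c.out r = (y r).val

end NoisyKOR

namespace NoisyKOR

/-! ### Reasoning about programs -/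

/-! Accuracy rests on signs. A position `j` with `x j = 1` flips entry `k` of level `i` with
probability `w j / (n * 2 ^ (i + 1))`, independently over `j`. So the expected sign of a noiseless
entry is the product `meanSign` of the factors `1 - w j / (n * 2 ^ i)`, and `-(n * 2 ^ i * log
(meanSign))` is the weight up to a factor `1 + 2 / n` (`log_meanSign_bounds`). Noise multiplies an
expected sign by `ε / (2 + ε)`, which `levelStat` divides out again.

The entries of a level are dependent, so concentration comes from exponential moments computed
position by position. `lintegral_hits_le` is an induction over positions in which each flip
contracts the sum of signs and adds a small error; the errors telescope to at most `2 * lam ^ 2 *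
n`, however many positions there are. With the noise (`lintegral_noise_le`), a Chernoff bound and a
union bound, this gives `levelStat_concentration`: with `n` of order `log u / (ε * β) ^ 2`, all
levels are simultaneously within `β / 100` of their means.

On that event the first level with statistic at least `1 / 2` exists, since the last level has mean
close to `1`. There the logarithm is Lipschitz. If this is not level `0`, failure of the preceding
level forces `n * 2 ^ i` to be of the order of the weight, so the error is relative; at level `0` it
is at most `n`. This is `estimate_error`.

Privacy: the dyadic intervals are disjoint, so a column of the sketch has at most one non-zero entry
(`sketch_apply_of_mem`). Changing one entry of `x` therefore moves at most one output bit, whose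
noise masses have ratio `1 + ε ≤ exp ε`.

The programs are treated by a step-counting Hoare calculus based on `Reaches`. `estimator_spec` and
`sketcher_spec` give running time and output for every input, and `map_coinNoise` identifies the law
of the noise that the second program draws. -/

/-- Started in `c`, the program reaches a configuration satisfying `Q` after at most `t` steps. -/
def Reaches (P : Program) (e : Env) (c : Config) (t : ℕ) (Q : Config → Prop) : Prop :=
  ∃ k ≤ t, Q ((step P e)^[k] c)

theorem Reaches.refl {P : Program} {e : Env} {c : Config} {t : ℕ} {Q : Config → Prop} (h : Q c) :
    Reaches P e c t Q :=
  ⟨0, Nat.zero_le _, h⟩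

theorem Reaches.mono {P : Program} {e : Env} {c : Config} {t t' : ℕ} {Q Q' : Config → Prop}
    (h : Reaches P e c t Q) (ht : t ≤ t') (hQ : ∀ c, Q c → Q' c) : Reaches P e c t' Q' := by
  obtain ⟨k, hk, h⟩ := h
  exact ⟨k, hk.trans ht, hQ _ h⟩

theorem Reaches.trans {P : Program} {e : Env} {c : Config} {t t' : ℕ} {Q Q' : Config → Prop}
    (h : Reaches P e c t Q) (h' : ∀ c, Q c → Reaches P e c t' Q') :
    Reaches P e c (t + t') Q' := by
  obtain ⟨k, hk, h⟩ := h
  obtain ⟨k', hk', h'⟩ := h' _ h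
  refine ⟨k' + k, by omega, ?_⟩
  rwa [Function.iterate_add_apply]

theorem Reaches.step {P : Program} {e : Env} {c : Config} {t : ℕ} {Q : Config → Prop}
    {i : Instr} (hi : P[c.pc]? = some i) (h : Reaches P e (exec e c i) t Q) :
    Reaches P e c (t + 1) Q := by
  obtain ⟨k, hk, h⟩ := h
  refine ⟨k + 1, by omega, ?_⟩
  rw [Function.iterate_succ_apply]
  have : NoisyKOR.step P e c = exec e c i := by simp [NoisyKOR.step, hi]
  rwa [this]

/-- A loop with at most `m` rounds of at most `t` steps and the possibility of an early exit. -/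
theorem Reaches.loop {P : Program} {e : Env} {t m : ℕ} {J : ℕ → Config → Prop}
    {Q : Config → Prop}
    (h : ∀ i < m, ∀ c, J i c → Reaches P e c t fun c' => J (i + 1) c' ∨ Q c')
    {c : Config} (h0 : J 0 c) : Reaches P e c (m * t) fun c' => J m c' ∨ Q c' := by
  suffices H : ∀ i ≤ m, Reaches P e c (i * t) fun c' => J i c' ∨ Q c' from H m le_rfl
  intro i
  induction i with
  | zero => exact fun _ => Reaches.refl (Or.inl h0)
  | succ i ih =>
    intro hi
    refine ((ih (by omega)).trans (t' := t) ?_).mono (by rw [Nat.succ_mul]) fun _ h => h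
    rintro c (hc | hc)
    · exact h i (by omega) c hc
    · exact Reaches.refl (Or.inr hc)

/-- A loop with exactly `m` rounds of at most `t` steps. -/
theorem Reaches.for {P : Program} {e : Env} {t m : ℕ} {J : ℕ → Config → Prop}
    (h : ∀ i < m, ∀ c, J i c → Reaches P e c t (J (i + 1)))
    {c : Config} (h0 : J 0 c) : Reaches P e c (m * t) (J m) :=
  (Reaches.loop (Q := fun _ => False)
    (fun i hi c hc => (h i hi c hc).mono le_rfl fun _ => Or.inl) h0).mono le_rfl fun _ h => by
      simpa using h

theorem Reaches.haltsWithin {P : Program} {e : Env} {c : Config} {t : ℕ} {Q : Config → Prop}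
    (h : Reaches P e c t Q) (hQ : ∀ c, Q c → P.length ≤ c.pc) {T : ℝ} (hT : (t : ℝ) ≤ T) :
    ∃ c', HaltsWithin P e c T c' ∧ Q c' := by
  obtain ⟨k, hk, h⟩ := h
  exact ⟨_, ⟨k, le_trans (by exact_mod_cast hk) hT, rfl, hQ _ h⟩, h⟩

/-! ### The estimator -/

/-- Compute `t = (2 + ε) / (n ε) · ∑ₖ (-1) ^ yₖ` for the levels in turn, up to the first level `i`
with `1 / 2 ≤ t`, and return `-n 2ⁱ log t`. -/
def estimator : Program :=
  [.const 4 1, .rconst 2 1, .radd 3 2 2, .radd 4 3 0, .rdiv 4 4 0, .rdiv 3 2 3, .rconst 7 1,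
   .jle 1 5 31, .const 6 0, .rconst 5 0, .rconst 6 0,
   .jle 2 6 21, .query 8 0 7, .jle 8 9 16, .rsub 5 5 2, .jle 9 9 17, .radd 5 5 2,
   .radd 6 6 2, .add 6 6 4, .add 7 7 4, .jle 9 9 11,
   .rdiv 8 5 6, .rmul 8 8 4, .rjle 3 8 27, .add 5 5 4, .radd 7 7 7, .jle 9 9 7,
   .rlog 8 8, .rmul 8 8 6, .rmul 8 8 7, .rsub 0 9 8]

/-- The sign `(-1) ^ b` of a bit. -/
def sgn (b : ZMod 2) : ℝ := if b = 0 then 1 else -1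

/-- The normalized sum of signs in level `i`. -/
noncomputable def levelStat {L n : ℕ} (ε : ℝ) (y : Fin (L * n) → ZMod 2) (i : Fin L) : ℝ :=
  (∑ k : Fin n, sgn (y (finProdFinEquiv (i, k)))) / n * ((2 + ε) / ε)

/-- The input of the estimator. -/
abbrev estimatorEnv {m : ℕ} (y : Fin m → ZMod 2) : Env where
  natIn := fun k => if k = 0 then toArray fun r => (y r).val else fun _ => 0
  realIn := fun _ _ => 0
  coins := fun _ => 0

/-- The registers of the estimator in level `i`, with `p` entries of the sketch already read, the
last `k` of them in this level, and sum of signs `T`. -/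
structure EstRow (L n : ℕ) (ε : ℝ) (pc i k p : ℕ) (T r : ℝ) (c : Config) : Prop where
  pc : c.pc = pc
  N1 : c.N 1 = L
  N2 : c.N 2 = n
  N4 : c.N 4 = 1
  N5 : c.N 5 = i
  N6 : c.N 6 = k
  N7 : c.N 7 = p
  N9 : c.N 9 = 0
  R2 : c.R 2 = 1
  R3 : c.R 3 = 1 / 2
  R4 : c.R 4 = (2 + ε) / ε
  R5 : c.R 5 = T
  R6 : c.R 6 = r
  R7 : c.R 7 = 2 ^ i
  R9 : c.R 9 = 0

/-- The row loop starts at instruction 11. As `N[9]` stays `0`, `jle 9 9 l` is an unconditional jump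
and `jle 8 9 16` tests for a zero bit. `R[6]` duplicates the counter `N[6]` because the machine
cannot convert naturals to reals and the row length is later needed as a divisor. -/
theorem estimator_inner {L n : ℕ} (ε : ℝ) (y : Fin (L * n) → ZMod 2) (i : Fin L) (k : ℕ)
    (hk : k < n) (T : ℝ) (c : Config) (hc : EstRow L n ε 11 i k (i * n + k) T k c) :
    Reaches estimator (estimatorEnv y) c 10
      (EstRow L n ε 11 i (k + 1) (i * n + (k + 1))
        (T + sgn (y (finProdFinEquiv (i, ⟨k, hk⟩)))) ((k + 1 : ℕ) : ℝ)) := by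
  obtain ⟨pc, N, R, o, d⟩ := c
  obtain ⟨h, h1, h2, h4, h5, h6, h7, h9, g2, g3, g4, g5, g6, g7, g9⟩ := hc
  dsimp only at *
  subst h
  have hlt : (i : ℕ) * n + k < L * n := by
    have := i.2
    nlinarith
  have hidx : (⟨(i : ℕ) * n + k, hlt⟩ : Fin (L * n)) = finProdFinEquiv (i, ⟨k, hk⟩) := by
    ext; simp [finProdFinEquiv]; ring
  have hq : toArray (fun r => (y r).val) ((i : ℕ) * n + k)
      = (y (finProdFinEquiv (i, ⟨k, hk⟩))).val := by
    simp [toArray, hlt, hidx]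
  refine Reaches.step (i := .jle 2 6 21) rfl ?_
  simp only [exec, h2, h6, not_le.2 hk, if_false]
  refine Reaches.step (i := .query 8 0 7) rfl ?_
  simp only [exec, h7, if_true, hq]
  refine Reaches.step (i := .jle 8 9 16) rfl ?_
  by_cases hb : y (finProdFinEquiv (i, ⟨k, hk⟩)) = 0
  · simp [exec, hb, h9]
    refine Reaches.step (i := .radd 5 5 2) rfl ?_
    refine Reaches.step (i := .radd 6 6 2) rfl ?_
    refine Reaches.step (i := .add 6 6 4) rfl ?_
    refine Reaches.step (i := .add 7 7 4) rfl ?_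
    refine Reaches.step (i := .jle 9 9 11) rfl ?_
    refine Reaches.refl ?_
    constructor <;> simp [exec, *, sgn, add_assoc]
  · have hv : ¬ (y (finProdFinEquiv (i, ⟨k, hk⟩))).val ≤ 0 := by simpa using hb
    simp only [exec, Function.update_self, ne_eq, Nat.reduceEqDiff, not_false_eq_true,
      Function.update_of_ne, h9, hv, if_false]
    refine Reaches.step (i := .rsub 5 5 2) rfl ?_
    refine Reaches.step (i := .jle 9 9 17) rfl ?_
    simp [exec]
    refine Reaches.step (i := .radd 6 6 2) rfl ?_
    refine Reaches.step (i := .add 6 6 4) rfl ?_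
    refine Reaches.step (i := .add 7 7 4) rfl ?_
    refine Reaches.step (i := .jle 9 9 11) rfl ?_
    refine Reaches.refl ?_
    constructor <;> simp [exec, *, sgn, add_assoc, sub_eq_add_neg]


theorem estimator_outer {L n : ℕ} (ε : ℝ) (y : Fin (L * n) → ZMod 2) (i : Fin L) (c : Config)
    (k : ℕ) (T r : ℝ) (hc : EstRow L n ε 7 i k (i * n) T r c) :
    Reaches estimator (estimatorEnv y) c (n * 10 + 15) fun c' =>
      (levelStat ε y i < 1 / 2 ∧ ∃ k T r, EstRow L n ε 7 (i + 1) k ((i + 1) * n) T r c') ∨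
      (1 / 2 ≤ levelStat ε y i ∧ c'.pc = 31 ∧
        c'.R 0 = -(n * 2 ^ (i : ℕ) * Real.log (levelStat ε y i))) := by
  have hinit : Reaches estimator (estimatorEnv y) c 4
      (EstRow L n ε 11 i 0 (i * n + 0) 0 (0 : ℕ)) := by
    obtain ⟨pc, N, R, o, d⟩ := c
    obtain ⟨h, h1, h2, h4, h5, h6, h7, h9, g2, g3, g4, g5, g6, g7, g9⟩ := hc
    dsimp only at *
    subst h
    refine Reaches.step (i := .jle 1 5 31) rfl ?_
    simp only [exec, h1, h5, not_le.2 i.2, if_false]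
    refine Reaches.step (i := .const 6 0) rfl ?_
    refine Reaches.step (i := .rconst 5 0) rfl ?_
    refine Reaches.step (i := .rconst 6 0) rfl ?_
    refine Reaches.refl ?_
    constructor <;> simp [exec, *]
  have hrow := hinit.trans (t' := n * 10) fun c hc => Reaches.for
    (J := fun k c => EstRow L n ε 11 i k (i * n + k)
      (∑ k' ∈ Finset.univ.filter fun k' : Fin n => (k' : ℕ) < k, sgn (y (finProdFinEquiv (i, k'))))
      k c)
    (fun k hk c hc => (estimator_inner ε y i k hk _ c hc).mono le_rfl fun c' hc' => by
      have : (Finset.univ.filter fun k' : Fin n => (k' : ℕ) < k + 1) =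
          insert ⟨k, hk⟩ (Finset.univ.filter fun k' : Fin n => (k' : ℕ) < k) := by
        ext k'
        simp only [Finset.mem_filter, Finset.mem_univ, true_and, Finset.mem_insert, Fin.ext_iff]
        omega
      rw [this, Finset.sum_insert (by simp), add_comm (sgn _)]
      exact hc')
    (by simpa using hc)
  refine (hrow.trans (t' := 8) ?_).mono (by omega) fun _ h => h
  intro c hc
  obtain ⟨pc, N, R, o, d⟩ := c
  obtain ⟨h, h1, h2, h4, h5, h6, h7, h9, g2, g3, g4, g5, g6, g7, g9⟩ := hc
  dsimp only at *
  subst h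
  have hstat : R 5 / R 6 * R 4 = levelStat ε y i := by
    rw [g4, g5, g6, levelStat]
    simp
  refine Reaches.step (i := .jle 2 6 21) rfl ?_
  simp only [exec, h2, h6, le_refl, if_true]
  refine Reaches.step (i := .rdiv 8 5 6) rfl ?_
  refine Reaches.step (i := .rmul 8 8 4) rfl ?_
  refine Reaches.step (i := .rjle 3 8 27) rfl ?_
  simp only [exec, Function.update_self, ne_eq, Nat.reduceEqDiff, not_false_eq_true,
      Function.update_of_ne, hstat, g3]
  by_cases hb : 1 / 2 ≤ levelStat ε y i
  · simp only [if_pos hb]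
    refine Reaches.step (i := .rlog 8 8) rfl ?_
    refine Reaches.step (i := .rmul 8 8 6) rfl ?_
    refine Reaches.step (i := .rmul 8 8 7) rfl ?_
    refine Reaches.step (i := .rsub 0 9 8) rfl ?_
    refine Reaches.refl (Or.inr ⟨hb, rfl, ?_⟩)
    simp [exec, *]
    ring
  · simp only [if_neg hb]
    refine Reaches.step (i := .add 5 5 4) rfl ?_
    refine Reaches.step (i := .radd 7 7 7) rfl ?_
    refine Reaches.step (i := .jle 9 9 7) rfl ?_
    refine Reaches.refl (Or.inl ⟨not_le.1 hb, n, R 5, n, ?_⟩)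
    constructor <;> simp [exec, *]
    all_goals ring

/-- If no level passes the threshold, nothing is claimed about `v`; `estimate_error` shows that this
case does not occur when the statistics are close to their means. -/
theorem estimator_spec {u n : ℕ} (ε β : ℝ) (hu : 2 ≤ u) (hn : 1 ≤ n)
    (y : Fin (sketchLen u n) → ZMod 2) {C : ℝ} (hC : 33 ≤ C) :
    ∃ v, Estimates estimator u n ε β y (C * sketchLen u n) v ∧
      ((∀ i, levelStat ε y i < 1 / 2) ∨
        ∃ i, 1 / 2 ≤ levelStat ε y i ∧ (∀ i' < i, levelStat ε y i' < 1 / 2) ∧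
          v = -(n * 2 ^ (i : ℕ) * Real.log (levelStat ε y i))) := by
  have hL : 1 ≤ levels u := Nat.clog_pos (by norm_num) hu
  have hinit : Reaches estimator (estimatorEnv y) (start [u, levels u, n] [ε, β]) 7
      (EstRow (levels u) n ε 7 0 0 0 0 0) := by
    refine Reaches.step (i := .const 4 1) rfl ?_
    refine Reaches.step (i := .rconst 2 1) rfl ?_
    refine Reaches.step (i := .radd 3 2 2) rfl ?_
    refine Reaches.step (i := .radd 4 3 0) rfl ?_
    refine Reaches.step (i := .rdiv 4 4 0) rfl ?_
    refine Reaches.step (i := .rdiv 3 2 3) rfl ?_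
    refine Reaches.step (i := .rconst 7 1) rfl ?_
    refine Reaches.refl ?_
    constructor <;> simp [exec, start]
    all_goals norm_num
  have hloop := hinit.trans (t' := levels u * (n * 10 + 15)) fun c hc => Reaches.loop
    (J := fun i c => (∀ i' : Fin (levels u), (i' : ℕ) < i → levelStat ε y i' < 1 / 2) ∧
      ∃ k T r, EstRow (levels u) n ε 7 i k (i * n) T r c)
    (Q := fun c => c.pc = 31 ∧ ∃ i, 1 / 2 ≤ levelStat ε y i ∧
      (∀ i' < i, levelStat ε y i' < 1 / 2) ∧
          c.R 0 = -(n * 2 ^ (i : ℕ) * Real.log (levelStat ε y i)))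
    (fun i hi c hc => by
      obtain ⟨hlt, k, T, r, hc⟩ := hc
      refine (estimator_outer ε y ⟨i, hi⟩ c k T r hc).mono le_rfl ?_
      rintro c' (⟨h, hc'⟩ | ⟨h, hpc, hR⟩)
      · refine Or.inl ⟨fun i' hi' => ?_, hc'⟩
        rcases Nat.lt_succ_iff_lt_or_eq.1 hi' with h' | h'
        · exact hlt i' h'
        · have : i' = ⟨i, hi⟩ := Fin.ext h'
          exact this ▸ h
      · exact Or.inr ⟨hpc, ⟨i, hi⟩, h, fun i' hi' => hlt i' hi', hR⟩)
    ⟨fun i' hi' => absurd hi' (Nat.not_lt_zero _), 0, 0, 0, by simpa using hc⟩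
  have hfin := hloop.trans (t' := 1) (Q' := fun c => c.pc = 31 ∧
      ((∀ i, levelStat ε y i < 1 / 2) ∨
        ∃ i, 1 / 2 ≤ levelStat ε y i ∧ (∀ i' < i, levelStat ε y i' < 1 / 2) ∧
          c.R 0 = -(n * 2 ^ (i : ℕ) * Real.log (levelStat ε y i)))) (by
    rintro c (⟨hlt, k, T, r, hc⟩ | ⟨hpc, h⟩)
    · obtain ⟨pc, N, R, o, d⟩ := c
      obtain ⟨h, h1, h2, h4, h5, h6, h7, h9, g2, g3, g4, g5, g6, g7, g9⟩ := hc
      dsimp only at *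
      subst h
      refine Reaches.step (i := .jle 1 5 31) rfl ?_
      refine Reaches.refl ⟨?_, Or.inl fun i => hlt i i.2⟩
      simp [exec, h1, h5]
    · exact Reaches.refl ⟨hpc, Or.inr h⟩)
  obtain ⟨c, hc, -, hv⟩ := hfin.haltsWithin (T := C * sketchLen u n)
    (fun c hc => by rw [hc.1]; rfl) (by
      refine le_trans (b := (33 : ℝ) * sketchLen u n) ?_
        (mul_le_mul_of_nonneg_right hC (Nat.cast_nonneg _))
      -- Since `levels u` and `n` are at least `1`, the terms are bounded by `(8 + 10 + 15)` times
      -- the sketch length, whence `33`.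
      have : 7 + levels u * (n * 10 + 15) + 1 ≤ 33 * (levels u * n) := by nlinarith
      exact_mod_cast this)
  exact ⟨c.R 0, ⟨c, hc, rfl⟩, hv⟩

/-! ### The sketching program -/

theorem sketch_apply_of_le {u n : ℕ} {w : Fin u → ℝ} (h : Fin u → Fin n)
    {s : Fin u → unitInterval} {j : Fin u} (hw : 0 < w j)
    (hs : (s j : ℝ) ≤ w j / 2 ^ levels u) (r : Fin (sketchLen u n)) : sketch w h s r j = 0 := by
  have : (s j : ℝ) ≤ w j / 2 ^ ((r.divNat : ℕ) + 1) := hs.trans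
    (div_le_div_of_nonneg_left hw.le (by positivity)
      (pow_le_pow_right₀ (by norm_num) r.divNat.2))
  simp only [sketch, Set.mem_Ioc, not_lt.2 this, false_and, and_false, if_false]

theorem sketch_apply_of_lt {u n : ℕ} {w : Fin u → ℝ} (h : Fin u → Fin n)
    {s : Fin u → unitInterval} {j : Fin u} (hw : 0 < w j)
    (hs : w j < (s j : ℝ)) (r : Fin (sketchLen u n)) : sketch w h s r j = 0 := by
  have : ¬ (s j : ℝ) ≤ w j / 2 ^ (r.divNat : ℕ) := not_le.2 <| hs.trans_le' <|
    div_le_self hw.le (one_le_pow₀ (by norm_num))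
  simp only [sketch, Set.mem_Ioc, this, and_false, if_false]

/-- The intervals of different levels are disjoint, so a column has at most one non-zero entry. Both
the single bit flip per position in the program and the privacy bound depend on this. -/
theorem sketch_apply_of_mem {u n : ℕ} {w : Fin u → ℝ} (h : Fin u → Fin n)
    {s : Fin u → unitInterval} {j : Fin u} (hw : 0 < w j) (i : Fin (levels u))
    (hs : (s j : ℝ) ∈ Set.Ioc (w j / 2 ^ ((i : ℕ) + 1)) (w j / 2 ^ (i : ℕ)))
    (r : Fin (sketchLen u n)) :
    sketch w h s r j = if r = finProdFinEquiv (i, h j) then 1 else 0 := by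
  have hmono : ∀ a b : ℕ, a ≤ b → w j / 2 ^ b ≤ w j / 2 ^ a := fun a b hab =>
    div_le_div_of_nonneg_left hw.le (by positivity) (pow_le_pow_right₀ (by norm_num) hab)
  obtain ⟨⟨i', k⟩, rfl⟩ := finProdFinEquiv.surjective r
  have h1 : (finProdFinEquiv (i', k)).divNat = i' := congrArg Prod.fst
    (finProdFinEquiv.symm_apply_apply (i', k))
  have h2 : (finProdFinEquiv (i', k)).modNat = k := congrArg Prod.snd
    (finProdFinEquiv.symm_apply_apply (i', k))
  simp only [sketch, h1, h2, finProdFinEquiv.injective.eq_iff, Prod.mk.injEq]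
  congr 1
  refine propext ⟨fun ⟨hk, hlt, hle⟩ => ⟨?_, hk.symm⟩, fun ⟨hi, hk⟩ => ⟨hk.symm, hi ▸ hs⟩⟩
  by_contra hne
  rcases lt_or_gt_of_ne hne with hlt' | hgt
  · exact absurd (hlt.trans_le hs.2) (not_lt.2 (hmono _ _ hlt'))
  · exact absurd (hs.1.trans_le hle) (not_lt.2 (hmono _ _ hgt))

/-- Draw the noise bits into the cells from `32` on, then find the level of each listed position by
repeated halving of its weight and flip the corresponding bit, and finally write out the bits. -/
def sketcher : Program :=
  [.const 4 1, .const 13 32, .rconst 6 2, .radd 2 6 0, .rconst 7 1, .rdiv 2 7 2,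
   .jle 1 6 10, .add 7 7 2, .add 6 6 4, .jle 5 5 6,
   .jle 7 8 20, .rand 3, .const 10 0, .rjle 3 2 15, .jle 5 5 16, .const 10 1, .add 9 13 8,
   .store 9 10, .add 8 8 4, .jle 5 5 10,
   .const 8 0, .jle 3 8 43, .query 11 0 8, .query 12 1 11, .rquery 4 0 11, .rquery 3 1 11,
   .const 6 0, .rjle 3 4 29, .jle 5 5 41,
   .jle 1 6 41, .rdiv 5 4 6, .rjle 3 5 37, .add 9 13 12, .load 10 9, .sub 10 4 10, .store 9 10,
   .jle 5 5 41, .add 6 6 4, .add 12 12 2, .rdiv 4 4 6, .jle 5 5 29,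
   .add 8 8 4, .jle 5 5 21,
   .const 8 0, .jle 7 8 50, .add 9 13 8, .load 10 9, .write 8 10, .add 8 8 4, .jle 5 5 44]

/-- The input of the sketching program. -/
noncomputable abbrev sketcherEnv {u n : ℕ} (w : Fin u → ℝ) (h : Fin u → Fin n)
    (s : Fin u → unitInterval) (l : List (Fin u)) (ω : ℕ → unitInterval) : Env where
  natIn := fun k =>
    if k = 0 then toArray fun a => ((l.get a : Fin u) : ℕ)
    else if k = 1 then toArray fun j => (h j : ℕ)
    else fun _ => 0
  realIn := fun k =>
    if k = 0 then toArray w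
    else if k = 1 then toArray fun j => (s j : ℝ)
    else fun _ => 0
  coins := fun a => (ω a : ℝ)

-- All registers lie below the base address 32 of the bits, so `simp` can separate writes to
-- registers from writes to bits with this lemma and the next.
@[simp]
theorem update_apply_add {α : Type*} (f : ℕ → α) {a b : ℕ} (r : ℕ) (v : α) (ha : a < b) :
    Function.update f a v (b + r) = f (b + r) :=
  Function.update_of_ne (by omega) _ _

@[simp]
theorem update_add_apply {α : Type*} (f : ℕ → α) {a b : ℕ} (r : ℕ) (v : α) (ha : a < b) :
    Function.update f (b + r) v a = f a :=
  Function.update_of_ne (by omega) _ _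

/-- The registers of the sketching program, with the bits `B` in the cells from `32` on and the
loop counter `a`. -/
structure SketchMem {τ : ℕ} (L n m : ℕ) (p : ℝ) (pc a : ℕ) (B : Fin τ → ZMod 2) (c : Config) :
    Prop where
  pc : c.pc = pc
  N1 : c.N 1 = L
  N2 : c.N 2 = n
  N3 : c.N 3 = m
  N4 : c.N 4 = 1
  N5 : c.N 5 = 0
  N7 : c.N 7 = τ
  N8 : c.N 8 = a
  N13 : c.N 13 = 32
  R2 : c.R 2 = p
  R6 : c.R 6 = 2
  mem : ∀ r : Fin τ, c.N (32 + r) = (B r).val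

/-- The noise bits obtained from a sequence of random numbers. -/
noncomputable def coinNoise (τ : ℕ) (p : ℝ) (ω : ℕ → unitInterval) : Fin τ → ZMod 2 :=
  open Classical in fun r => if (ω r : ℝ) ≤ p then 1 else 0

/-- Natural cells have no multiplication, so the sketch length is obtained by adding `n` to itself
`levels u` times. -/
theorem sketcher_init {u n : ℕ} (ε β : ℝ) (m : ℕ) (e : Env) :
    Reaches sketcher e (start [u, levels u, n, m] [ε, β]) (7 + levels u * 4) fun c =>
      SketchMem (levels u) n m (1 / (2 + ε)) 10 0 (fun _ : Fin (sketchLen u n) => 0) c ∧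
        c.drawn = 0 := by
  have h0 : Reaches sketcher e (start [u, levels u, n, m] [ε, β]) 6 fun c =>
      SketchMem (levels u) n m (1 / (2 + ε)) 6 0 (fun _ : Fin 0 => 0) c ∧ c.drawn = 0 ∧
        c.N 6 = 0 ∧ ∀ r, c.N (32 + r) = 0 := by
    refine Reaches.step (i := .const 4 1) rfl ?_
    refine Reaches.step (i := .const 13 32) rfl ?_
    refine Reaches.step (i := .rconst 6 2) rfl ?_
    refine Reaches.step (i := .radd 2 6 0) rfl ?_
    refine Reaches.step (i := .rconst 7 1) rfl ?_
    refine Reaches.step (i := .rdiv 2 7 2) rfl ?_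
    refine Reaches.refl ⟨?_, ?_, ?_, ?_⟩
    · constructor <;> simp [exec, start]
    · simp [exec, start]
    · simp [exec, start]
    · intro r
      have : [u, levels u, n, m][32 + r]? = none := List.getElem?_eq_none (by simp; omega)
      simp [exec, start, this]
  have hloop := h0.trans (t' := levels u * 4) fun c hc => Reaches.for
    -- The type index `i * n` records the partial product in `N[7]`. It covers only the first `i *
    -- n` bits, so the invariant also carries that all cells from 32 on are zero.
    (J := fun i c => SketchMem (levels u) n m (1 / (2 + ε)) 6 0 (fun _ : Fin (i * n) => 0) c ∧
      c.drawn = 0 ∧ c.N 6 = i ∧ ∀ r, c.N (32 + r) = 0)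
    (fun i hi c hc => by
      obtain ⟨pc, N, R, o, d⟩ := c
      obtain ⟨⟨hp, h1, h2, h3, h4, h5, h7, h8, h13, g2, g6, hmem⟩, hd, h6, hmem'⟩ := hc
      dsimp only at *
      subst hp
      refine Reaches.step (i := .jle 1 6 10) rfl ?_
      simp only [exec, h1, h6, not_le.2 hi, if_false]
      refine Reaches.step (i := .add 7 7 2) rfl ?_
      refine Reaches.step (i := .add 6 6 4) rfl ?_
      refine Reaches.step (i := .jle 5 5 6) rfl ?_
      refine Reaches.refl ⟨?_, ?_, ?_, ?_⟩
      · constructor <;> simp [exec, *]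
        ring
      all_goals simp [exec, *])
    (c := c) ⟨by
      obtain ⟨⟨hp, h1, h2, h3, h4, h5, h7, h8, h13, g2, g6, hmem⟩, hc⟩ := hc
      constructor <;> simp [*], hc.2⟩
  refine (hloop.trans (t' := 1) ?_).mono (by omega) fun _ h => h
  intro c hc
  obtain ⟨pc, N, R, o, d⟩ := c
  obtain ⟨⟨hp, h1, h2, h3, h4, h5, h7, h8, h13, g2, g6, hmem⟩, hd, h6, hmem'⟩ := hc
  dsimp only at *
  subst hp
  refine Reaches.step (i := .jle 1 6 10) rfl ?_
  refine Reaches.refl ⟨?_, ?_⟩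
  · constructor <;> simp [exec, *]
  · simp [exec, *]

theorem sketcher_noise {u n : ℕ} (w : Fin u → ℝ) (h : Fin u → Fin n)
    (s : Fin u → unitInterval) (l : List (Fin u)) (ω : ℕ → unitInterval) {L m τ : ℕ} {p : ℝ}
    {c : Config} (hc : SketchMem L n m p 10 0 (fun _ : Fin τ => 0) c ∧ c.drawn = 0) :
    Reaches sketcher (sketcherEnv w h s l ω) c (τ * 10 + 2)
      (SketchMem L n m p 21 0 (coinNoise τ p ω)) := by
  classical
  have hloop := Reaches.for (P := sketcher) (e := sketcherEnv w h s l ω) (t := 10) (m := τ)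
    -- The clause `drawn = i` ties bit `i` to random number `i`, which makes the result the explicit
    -- function `coinNoise` of the stream.
    (J := fun i c => SketchMem L n m p 10 i
      (fun r : Fin τ => if (r : ℕ) < i then coinNoise τ p ω r else 0) c ∧ c.drawn = i)
    (fun i hi c hc => by
      obtain ⟨pc, N, R, o, d⟩ := c
      obtain ⟨⟨hp, h1, h2, h3, h4, h5, h7, h8, h13, g2, g6, hmem⟩, hd⟩ := hc
      dsimp only at *
      subst hp
      subst hd
      have hupd : ∀ b : ZMod 2, b = coinNoise τ p ω ⟨d, hi⟩ → ∀ (N' : ℕ → ℕ),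
          (∀ a, 32 ≤ a → N' a = N a) → ∀ r : Fin τ,
          Function.update N' (32 + d) b.val (32 + r) =
            (if (r : ℕ) < d + 1 then coinNoise τ p ω r else 0).val := by
        intro b hb N' hN' r
        rcases lt_trichotomy (r : ℕ) d with h' | h' | h'
        · rw [Function.update_of_ne (by omega), hN' _ (by omega), hmem, if_pos h',
            if_pos (by omega)]
        · rw [h', Function.update_self, if_pos (by omega), hb]
          congr 2
          exact Fin.ext h'.symm
        · rw [Function.update_of_ne (by omega), hN' _ (by omega), hmem, if_neg (by omega),
            if_neg (by omega)]
      refine Reaches.step (i := .jle 7 8 20) rfl ?_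
      simp only [exec, h7, h8, not_le.2 hi, if_false]
      refine Reaches.step (i := .rand 3) rfl ?_
      refine Reaches.step (i := .const 10 0) rfl ?_
      refine Reaches.step (i := .rjle 3 2 15) rfl ?_
      simp only [exec, Function.update_self, ne_eq, Nat.reduceEqDiff, not_false_eq_true,
        Function.update_of_ne, g2]
      by_cases hb : (ω d : ℝ) ≤ p
      · simp only [if_pos hb]
        refine Reaches.step (i := .const 10 1) rfl ?_
        refine Reaches.step (i := .add 9 13 8) rfl ?_
        refine Reaches.step (i := .store 9 10) rfl ?_
        refine Reaches.step (i := .add 8 8 4) rfl ?_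
        refine Reaches.step (i := .jle 5 5 10) rfl ?_
        refine Reaches.refl ⟨?_, ?_⟩
        · constructor
          case mem =>
            intro r
            have := hupd 1 (by simp [coinNoise, hb])
              (Function.update (Function.update (Function.update N 10 0) 10 1) 9 (32 + d))
              (fun a ha => by simp [show a ≠ 9 by omega,
                show a ≠ 10 by omega]) r
            simpa [exec, h13, h8, show ZMod.val (1 : ZMod 2) = 1 from rfl] using this
          all_goals simp [exec, *]
        · simp [exec, *]
      · simp only [if_neg hb]
        refine Reaches.step (i := .jle 5 5 16) rfl ?_
        simp only [exec, le_refl, if_true]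
        refine Reaches.step (i := .add 9 13 8) rfl ?_
        refine Reaches.step (i := .store 9 10) rfl ?_
        refine Reaches.step (i := .add 8 8 4) rfl ?_
        refine Reaches.step (i := .jle 5 5 10) rfl ?_
        refine Reaches.refl ⟨?_, ?_⟩
        · constructor
          case mem =>
            intro r
            have := hupd 0 (by simp [coinNoise, hb])
              (Function.update (Function.update N 10 0) 9 (32 + d))
              (fun a ha => by simp [show a ≠ 9 by omega,
                show a ≠ 10 by omega]) r
            simpa [exec, h13, h8] using this
          all_goals simp [exec, *]
        · simp [exec, *])
    (c := c) (by simpa using hc)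
  refine hloop.trans (t' := 2) ?_
  intro c hc
  obtain ⟨pc, N, R, o, d⟩ := c
  obtain ⟨⟨hp, h1, h2, h3, h4, h5, h7, h8, h13, g2, g6, hmem⟩, hd⟩ := hc
  dsimp only at *
  subst hp
  refine Reaches.step (i := .jle 7 8 20) rfl ?_
  simp only [exec, h7, h8, le_refl, if_true]
  refine Reaches.step (i := .const 8 0) rfl ?_
  refine Reaches.refl ?_
  constructor <;> simp [exec, *]

theorem sketcher_output {τ L n m : ℕ} {p : ℝ} (e : Env) {B : Fin τ → ZMod 2} {c : Config}
    (hc : SketchMem L n m p 43 m B c) :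
    Reaches sketcher e c (τ * 6 + 2) fun c' =>
      c'.pc = 50 ∧ ∀ r : Fin τ, c'.out r = (B r).val := by
  have h0 : Reaches sketcher e c 1 (SketchMem L n m p 44 0 B) := by
    obtain ⟨pc, N, R, o, d⟩ := c
    obtain ⟨hp, h1, h2, h3, h4, h5, h7, h8, h13, g2, g6, hmem⟩ := hc
    dsimp only at *
    subst hp
    refine Reaches.step (i := .const 8 0) rfl ?_
    refine Reaches.refl ?_
    constructor <;> simp [exec, *]
  have hloop := h0.trans (t' := τ * 6) fun c hc => Reaches.for
    (J := fun i c => SketchMem L n m p 44 i B c ∧ ∀ r : Fin τ, (r : ℕ) < i → c.out r = (B r).val)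
    (fun i hi c hc => by
      obtain ⟨pc, N, R, o, d⟩ := c
      obtain ⟨⟨hp, h1, h2, h3, h4, h5, h7, h8, h13, g2, g6, hmem⟩, hout⟩ := hc
      dsimp only at *
      subst hp
      refine Reaches.step (i := .jle 7 8 50) rfl ?_
      simp only [exec, h7, h8, not_le.2 hi, if_false]
      refine Reaches.step (i := .add 9 13 8) rfl ?_
      refine Reaches.step (i := .load 10 9) rfl ?_
      refine Reaches.step (i := .write 8 10) rfl ?_
      refine Reaches.step (i := .add 8 8 4) rfl ?_
      refine Reaches.step (i := .jle 5 5 44) rfl ?_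
      have hi' := hmem ⟨i, hi⟩
      dsimp only at hi'
      refine Reaches.refl ⟨?_, fun r hr => ?_⟩
      · constructor <;> simp [exec, *]
      · rcases Nat.lt_succ_iff_lt_or_eq.1 hr with h' | h'
        · simp [exec, *, Function.update_apply, h'.ne]
        · subst h'
          simp [exec, *])
    (c := c) ⟨hc, fun r hr => absurd hr (Nat.not_lt_zero _)⟩
  refine (hloop.trans (t' := 1) ?_).mono (by omega) fun _ h => h
  intro c hc
  obtain ⟨pc, N, R, o, d⟩ := c
  obtain ⟨⟨hp, h1, h2, h3, h4, h5, h7, h8, h13, g2, g6, hmem⟩, hout⟩ := hc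
  dsimp only at *
  subst hp
  refine Reaches.step (i := .jle 7 8 50) rfl ?_
  refine Reaches.refl ⟨?_, fun r => hout r r.2⟩
  simp [exec, *]

/-- After `i` halvings `R[4]` is the upper end of the interval of level `i` and `N[12]` is the row
`h j + n * i`. The loop stops at the first level whose lower end is below `s j`; if the levels run
out, the whole column is zero. -/
theorem sketcher_level {u n : ℕ} {w : Fin u → ℝ} (h : Fin u → Fin n)
    {s : Fin u → unitInterval} (l : List (Fin u)) (ω : ℕ → unitInterval) {m a : ℕ} {p : ℝ}
    {j : Fin u} (hw : 0 < w j) (B : Fin (sketchLen u n) → ZMod 2) {c : Config}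
    (hc : SketchMem (levels u) n m p 29 a B c ∧ c.N 6 = 0 ∧ c.N 12 = h j ∧ c.R 3 = s j ∧
      c.R 4 = w j) (hs : (s j : ℝ) ≤ w j) :
    Reaches sketcher (sketcherEnv w h s l ω) c (levels u * 8 + 1)
      (SketchMem (levels u) n m p 41 a fun r => B r + sketch w h s r j) := by
  have hloop := Reaches.loop (P := sketcher) (e := sketcherEnv w h s l ω) (t := 8) (m := levels u)
    (J := fun i c => SketchMem (levels u) n m p 29 a B c ∧ c.N 6 = i ∧
      c.N 12 = h j + n * i ∧ c.R 3 = s j ∧ c.R 4 = w j / 2 ^ i ∧ (s j : ℝ) ≤ w j / 2 ^ i)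
    (Q := SketchMem (levels u) n m p 41 a fun r => B r + sketch w h s r j)
    (fun i hi c hc => by
      obtain ⟨pc, N, R, o, d⟩ := c
      obtain ⟨⟨hp, h1, h2, h3, h4, h5, h7, h8, h13, g2, g6, hmem⟩, h6, h12, g3, g4, hle⟩ := hc
      dsimp only at *
      subst hp
      have hhalf : w j / 2 ^ i / 2 = w j / 2 ^ (i + 1) := by rw [pow_succ, div_div]
      refine Reaches.step (i := .jle 1 6 41) rfl ?_
      simp only [exec, h1, h6, not_le.2 hi, if_false]
      refine Reaches.step (i := .rdiv 5 4 6) rfl ?_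
      refine Reaches.step (i := .rjle 3 5 37) rfl ?_
      simp only [exec, Function.update_self, ne_eq, Nat.reduceEqDiff, not_false_eq_true,
        Function.update_of_ne, g3, g4, g6, hhalf]
      by_cases hb : (s j : ℝ) ≤ w j / 2 ^ (i + 1)
      · simp only [if_pos hb]
        refine Reaches.step (i := .add 6 6 4) rfl ?_
        refine Reaches.step (i := .add 12 12 2) rfl ?_
        refine Reaches.step (i := .rdiv 4 4 6) rfl ?_
        refine Reaches.step (i := .jle 5 5 29) rfl ?_
        refine Reaches.refl (Or.inl ⟨?_, ?_, ?_, ?_, ?_, hb⟩)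
        · constructor <;> simp [exec, *]
        all_goals simp [exec, *]
        ring
      · simp only [if_neg hb]
        have hcol := sketch_apply_of_mem h hw ⟨i, hi⟩ ⟨not_le.1 hb, hle⟩
        have hidx : ((finProdFinEquiv (⟨i, hi⟩, h j) : Fin (sketchLen u n)) : ℕ)
          = h j + n * i := rfl
        generalize finProdFinEquiv (⟨i, hi⟩, h j) = r₀ at hcol hidx
        refine Reaches.step (i := .add 9 13 12) rfl ?_
        refine Reaches.step (i := .load 10 9) rfl ?_
        refine Reaches.step (i := .sub 10 4 10) rfl ?_
        refine Reaches.step (i := .store 9 10) rfl ?_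
        refine Reaches.step (i := .jle 5 5 41) rfl ?_
        refine Reaches.refl (Or.inr ?_)
        rw [← hidx] at h12
        clear hidx
        constructor
        case mem =>
          intro r
          rw [hcol]
          by_cases hr : r = r₀
          · have hflip : ∀ b : ZMod 2, 1 - b.val = (b + 1).val := by decide
            subst hr
            simp [exec, *]
          · have hne : 32 + (r : ℕ) ≠ 32 + (r₀ : ℕ) := fun h' => hr (Fin.ext (by omega))
            simp [exec, *, Function.update_of_ne hne]
        all_goals simp [exec, *])
    (c := c) ⟨hc.1, hc.2.1, by simpa using hc.2.2.1, hc.2.2.2.1, by simpa using hc.2.2.2.2,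
      by simpa using hs⟩
  refine hloop.trans (t' := 1) ?_
  rintro c (hc | hc)
  · obtain ⟨pc, N, R, o, d⟩ := c
    obtain ⟨⟨hp, h1, h2, h3, h4, h5, h7, h8, h13, g2, g6, hmem⟩, h6, h12, g3, g4, hle⟩ := hc
    dsimp only at *
    subst hp
    refine Reaches.step (i := .jle 1 6 41) rfl ?_
    refine Reaches.refl ?_
    have hcol := sketch_apply_of_le h hw hle
    constructor <;> simp [exec, *]
  · exact Reaches.refl hc

theorem sketcher_element {u n : ℕ} {w : Fin u → ℝ} (hw : ∀ j, 0 < w j) (h : Fin u → Fin n)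
    {s : Fin u → unitInterval} (l : List (Fin u)) (ω : ℕ → unitInterval) {a : ℕ} {p : ℝ}
    (ha : a < l.length) (B : Fin (sketchLen u n) → ZMod 2) {c : Config}
    (hc : SketchMem (levels u) n l.length p 21 a B c) :
    Reaches sketcher (sketcherEnv w h s l ω) c (levels u * 8 + 11)
      (SketchMem (levels u) n l.length p 21 (a + 1) fun r => B r + sketch w h s r l[a]) := by
  have hj : toArray (fun a => ((l.get a : Fin u) : ℕ)) a = l[a] := by simp [toArray, ha]
  have hh : toArray (fun j => (h j : ℕ)) (l[a] : ℕ) = h l[a] := by simp [toArray]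
  have hw' : toArray w (l[a] : ℕ) = w l[a] := by simp [toArray]
  have hs' : toArray (fun j => (s j : ℝ)) (l[a] : ℕ) = s l[a] := by simp [toArray]
  generalize l[a] = j at hj hh hw' hs'
  have hbody : Reaches sketcher (sketcherEnv w h s l ω) c (8 + (levels u * 8 + 1))
      (SketchMem (levels u) n l.length p 41 a fun r => B r + sketch w h s r j) := by
    obtain ⟨pc, N, R, o, d⟩ := c
    obtain ⟨hp, h1, h2, h3, h4, h5, h7, h8, h13, g2, g6, hmem⟩ := hc
    dsimp only at *
    subst hp
    -- The budget is written as iterated successors so that each `Reaches.step` can peel one off.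
    refine Reaches.mono (t := levels u * 8 + 1 + 1 + 1 + 1 + 1 + 1 + 1 + 1 + 1) ?_ (by omega)
      fun _ h => h
    refine Reaches.step (i := .jle 3 8 43) rfl ?_
    simp only [exec, h3, h8, not_le.2 ha, if_false]
    refine Reaches.step (i := .query 11 0 8) rfl ?_
    refine Reaches.step (i := .query 12 1 11) rfl ?_
    refine Reaches.step (i := .rquery 4 0 11) rfl ?_
    refine Reaches.step (i := .rquery 3 1 11) rfl ?_
    refine Reaches.step (i := .const 6 0) rfl ?_
    refine Reaches.step (i := .rjle 3 4 29) rfl ?_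
    simp only [exec, Function.update_self, ne_eq, Nat.reduceEqDiff, not_false_eq_true,
        Function.update_of_ne, h8, if_true, hj, hh, hw', hs', one_ne_zero, if_false]
    by_cases hb : (s j : ℝ) ≤ w j
    · simp only [if_pos hb]
      refine (sketcher_level h l ω (hw j) B ⟨?_, ?_, ?_, ?_, ?_⟩ hb).mono (by omega) fun _ h => h
      · constructor <;> simp [*]
      all_goals simp [*]
    · simp only [if_neg hb]
      refine Reaches.step (i := .jle 5 5 41) rfl ?_
      refine Reaches.refl ?_
      have hcol := sketch_apply_of_lt (s := s) h (hw j) (not_le.1 hb)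
      constructor <;> simp [exec, *]
  refine (hbody.trans (t' := 2) ?_).mono (by omega) fun _ h => h
  intro c hc
  obtain ⟨pc, N, R, o, d⟩ := c
  obtain ⟨hp, h1, h2, h3, h4, h5, h7, h8, h13, g2, g6, hmem⟩ := hc
  dsimp only at *
  subst hp
  refine Reaches.step (i := .add 8 8 4) rfl ?_
  refine Reaches.step (i := .jle 5 5 21) rfl ?_
  refine Reaches.refl ?_
  constructor <;> simp [exec, *]

theorem sketcher_spec {u n : ℕ} (ε β : ℝ) (hu : 2 ≤ u) {w : Fin u → ℝ}
    (hw : ∀ j, 0 < w j) (h : Fin u → Fin n) (s : Fin u → unitInterval)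
    (l : List (Fin u)) (ω : ℕ → unitInterval) {T : ℝ} (hn : 1 ≤ n)
    (hT : ((l.length * levels u * 19 + sketchLen u n * 32 : ℕ) : ℝ) ≤ T) :
    Sketches sketcher ε β w h s l ω T fun r =>
      coinNoise (sketchLen u n) (1 / (2 + ε)) ω r + (l.map (sketch w h s r)).sum := by
  have hL : 1 ≤ levels u := Nat.clog_pos (by norm_num) hu
  have hloop := ((sketcher_init (u := u) (n := n) ε β l.length (sketcherEnv w h s l ω)).trans
    fun c hc => sketcher_noise w h s l ω hc).trans (t' := l.length * (levels u * 8 + 11))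
      fun c hc => Reaches.for
        (J := fun a => SketchMem (levels u) n l.length (1 / (2 + ε)) 21 a fun r =>
          coinNoise (sketchLen u n) (1 / (2 + ε)) ω r + ((l.take a).map (sketch w h s r)).sum)
        (fun a ha c hc => by
          refine (sketcher_element hw h l ω ha _ hc).mono le_rfl fun c' hc' => ?_
          simp only [← List.take_concat_get' l a ha, List.map_append, List.sum_append,
            List.map_singleton, List.sum_singleton, ← add_assoc]
          exact hc')
        (by simpa using hc)
  have hexit := hloop.trans (t' := 1) (Q' := SketchMem (levels u) n l.length (1 / (2 + ε)) 43
      l.length fun r => coinNoise (sketchLen u n) (1 / (2 + ε)) ω r +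
        (l.map (sketch w h s r)).sum) (by
    intro c hc
    obtain ⟨pc, N, R, o, d⟩ := c
    obtain ⟨hp, h1, h2, h3, h4, h5, h7, h8, h13, g2, g6, hmem⟩ := hc
    dsimp only at *
    subst hp
    refine Reaches.step (i := .jle 3 8 43) rfl ?_
    refine Reaches.refl ?_
    constructor <;> simp [exec, *])
  have hout := hexit.trans fun c hc => sketcher_output (sketcherEnv w h s l ω) hc
  obtain ⟨c, hc, -, hc'⟩ := hout.haltsWithin (T := T) (fun c hc => by rw [hc.1]; rfl) (by
    refine le_trans (Nat.cast_le.2 ?_) hT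
    -- The phases add up to `12 + 4 L + 16 L n + m (8 L + 11)` for `L` levels and `m` listed
    -- positions. With `1 ≤ L` and `1 ≤ n` this is at most `19 m L + 32 L n`.
    have : levels u * 1 ≤ levels u * n := Nat.mul_le_mul_left _ hn
    have : l.length * 1 ≤ l.length * levels u := Nat.mul_le_mul_left _ hL
    simp only [sketchLen]
    nlinarith)
  exact ⟨c, hc, hc'⟩

/-! ### Noise and privacy -/

theorem measurable_coinNoise (τ : ℕ) (p : ℝ) : Measurable (coinNoise τ p) := by
  classical
  refine measurable_pi_lambda _ fun r => ?_
  unfold coinNoise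
  refine Measurable.ite ?_ measurable_const measurable_const
  exact measurableSet_le (measurable_subtype_coe.comp (measurable_pi_apply _)) measurable_const

theorem map_volume_ite_le (p : unitInterval) :
    (volume : Measure unitInterval).map
      (open Classical in fun ω : unitInterval => if (ω : ℝ) ≤ (p : ℝ) then (1 : ZMod 2) else 0) =
        bernoulliMeasure 1 0 p := by
  classical
  ext S hS
  rw [Measure.map_apply (Measurable.ite (measurableSet_le measurable_subtype_coe measurable_const)
    measurable_const measurable_const) hS, bernoulliMeasure_apply p hS]
  by_cases h1 : (1 : ZMod 2) ∈ S <;> by_cases h0 : (0 : ZMod 2) ∈ S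
  · rw [if_pos h1, if_pos h0, ← measure_univ (μ := (volume : Measure unitInterval))]
    congr 1
    ext ω
    by_cases h : ω ≤ p <;> simp [h, h1, h0]
  · rw [if_pos h1, if_neg h0]
    trans (volume : Measure unitInterval) (Set.Iic p)
    · congr 1
      ext ω
      by_cases h : ω ≤ p <;> simp [h, h1, h0]
    · rw [unitInterval.volume_Iic, ENNReal.ofReal]
      congr 1
      exact Real.toNNReal_of_nonneg p.2.1
  · rw [if_neg h1, if_pos h0]
    trans (volume : Measure unitInterval) (Set.Ioi p)
    · congr 1
      ext ω
      by_cases h : ω ≤ p <;> simp [h, h1, h0, ← not_le]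
    · rw [unitInterval.volume_Ioi, ENNReal.ofReal]
      congr 1
      exact Real.toNNReal_of_nonneg (unitInterval.symm p).2.1
  · rw [if_neg h1, if_neg h0, ← measure_empty (μ := (volume : Measure unitInterval))]
    congr 1
    ext ω
    by_cases h : ω ≤ p <;> simp [h, h1, h0]

theorem coe_projIcc_noise {ε : ℝ} (hε : 0 < ε) :
    (Set.projIcc (0 : ℝ) 1 zero_le_one (1 / (2 + ε)) : ℝ) = 1 / (2 + ε) := by
  rw [Set.projIcc_of_mem zero_le_one (x := 1 / (2 + ε)) ⟨by positivity, by
    rw [div_le_one (by positivity)]; linarith⟩]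

/-- The preimage of a box is a cylinder constraining only the first `τ` random numbers, so its mass
under the infinite product is a finite product of Bernoulli masses. -/
theorem map_coinNoise (τ : ℕ) {ε : ℝ} (hε : 0 < ε) :
    coinDist.map (coinNoise τ (1 / (2 + ε))) = noiseDist τ ε := by
  classical
  refine (Measure.pi_eq fun t ht => ?_).symm
  rw [Measure.map_apply (measurable_coinNoise _ _) (MeasurableSet.univ_pi ht)]
  set p := Set.projIcc (0 : ℝ) 1 zero_le_one (1 / (2 + ε)) with hp
  have hpv : (p : ℝ) = 1 / (2 + ε) := coe_projIcc_noise hε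
  set f : unitInterval → ZMod 2 := fun ω => if (ω : ℝ) ≤ (p : ℝ) then (1 : ZMod 2) else 0 with hf
  have hfm : Measurable f := Measurable.ite
    (measurableSet_le measurable_subtype_coe measurable_const) measurable_const measurable_const
  have hset : coinNoise τ (1 / (2 + ε)) ⁻¹' Set.univ.pi t = Set.pi (Finset.range τ : Finset ℕ)
      fun a => if h : a < τ then f ⁻¹' t ⟨a, h⟩ else Set.univ := by
    ext ω
    simp only [Set.mem_preimage, Set.mem_pi, Set.mem_univ, true_imp_iff, Finset.coe_range,
      Set.mem_Iio]
    refine ⟨fun H a ha => ?_, fun H r => ?_⟩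
    · rw [dif_pos ha]
      have := H ⟨a, ha⟩
      simpa [hf, coinNoise, hpv] using this
    · have := H r r.2
      rw [dif_pos r.2] at this
      simpa [hf, coinNoise, hpv] using this
  rw [hset, coinDist, Measure.infinitePi_pi _ (by
    intro a _
    split_ifs with h
    · exact hfm (ht _)
    · exact MeasurableSet.univ), Finset.prod_range]
  refine Finset.prod_congr rfl fun r _ => ?_
  rw [dif_pos r.2, ← map_volume_ite_le p, Measure.map_apply hfm (ht r)]

theorem noise_singleton {ε : ℝ} (hε : 0 < ε) (c : ZMod 2) :
    bernoulliMeasure (1 : ZMod 2) 0 (Set.projIcc 0 1 zero_le_one (1 / (2 + ε))) {c} =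
      ENNReal.ofReal (if c = 1 then 1 / (2 + ε) else (1 + ε) / (2 + ε)) := by
  have hp := coe_projIcc_noise hε
  set p := Set.projIcc (0 : ℝ) 1 zero_le_one (1 / (2 + ε))
  have hc : c = 0 ∨ c = 1 := by revert c; decide
  rw [← ENNReal.ofReal_toReal (measure_ne_top _ {c})]
  congr 1
  change (bernoulliMeasure (1 : ZMod 2) 0 p).real {c} = _
  rcases hc with rfl | rfl
  · rw [bernoulliMeasure_real_apply_of_notMem_of_mem _ (measurableSet_singleton _)
      (by decide) (by simp), hp, if_neg (by decide)]
    field_simp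
    ring
  · rw [bernoulliMeasure_real_apply_of_mem_of_notMem _ (measurableSet_singleton _)
      (by simp) (by decide), hp, if_pos rfl]

/-- The masses are `1` and `1 + ε`, each divided by `2 + ε`, so no ratio exceeds `1 + ε ≤ exp ε`.
This is the reason for the flip probability `1 / (2 + ε)`. -/
theorem bernoulliMeasure_singleton_le {ε : ℝ} (hε : 0 < ε) (a b : ZMod 2) :
    bernoulliMeasure (1 : ZMod 2) 0 (Set.projIcc 0 1 zero_le_one (1 / (2 + ε))) {a} ≤
      ENNReal.ofReal (Real.exp ε) *
        bernoulliMeasure (1 : ZMod 2) 0 (Set.projIcc 0 1 zero_le_one (1 / (2 + ε))) {b} := by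
  have hexp : 1 + ε ≤ Real.exp ε := by linarith [Real.add_one_le_exp ε]
  rw [noise_singleton hε, noise_singleton hε, ← ENNReal.ofReal_mul (Real.exp_pos _).le]
  refine ENNReal.ofReal_le_ofReal ?_
  have h2 : 0 < 2 + ε := by linarith
  have hle : ∀ c : ZMod 2, 1 / (2 + ε) ≤ if c = 1 then 1 / (2 + ε) else (1 + ε) / (2 + ε) := by
    intro c
    split_ifs
    · exact le_rfl
    · gcongr
      linarith
  calc (if a = 1 then 1 / (2 + ε) else (1 + ε) / (2 + ε)) ≤ (1 + ε) / (2 + ε) := by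
        split_ifs
        · gcongr
          linarith
        · exact le_rfl
    _ = (1 + ε) * (1 / (2 + ε)) := by ring
    _ ≤ _ := mul_le_mul hexp (hle b) (by positivity) (Real.exp_pos _).le

/-- The hypothesis `hv` says that `v` and `v'` differ in at most one coordinate. A point mass of the
shifted noise is a product over coordinates, so at most one factor changes; summing over the finite
set `W` gives the claim. -/
theorem map_add_noiseDist_le {τ : ℕ} {ε : ℝ} (hε : 0 < ε) {v v' : Fin τ → ZMod 2}
    (hv : ∀ r r', v r ≠ v' r → v r' ≠ v' r' → r = r') (W : Set (Fin τ → ZMod 2)) :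
    (noiseDist τ ε).map (fun φ => v + φ) W ≤
      ENNReal.ofReal (Real.exp ε) * (noiseDist τ ε).map (fun φ => v' + φ) W := by
  classical
  have hone : 1 ≤ ENNReal.ofReal (Real.exp ε) :=
    ENNReal.one_le_ofReal.2 (Real.one_le_exp hε.le)
  have hsingle : ∀ (v y : Fin τ → ZMod 2), (noiseDist τ ε).map (fun φ => v + φ) {y} =
      ∏ r, bernoulliMeasure (1 : ZMod 2) 0 (Set.projIcc 0 1 zero_le_one (1 / (2 + ε)))
        {y r - v r} := by
    intro v y
    rw [Measure.map_apply Measurable.of_discrete (measurableSet_singleton y), noiseDist,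
      show (fun φ : Fin τ → ZMod 2 => v + φ) ⁻¹' {y} = {y - v} by
        ext φ
        rw [Set.mem_preimage, Set.mem_singleton_iff, Set.mem_singleton_iff, eq_sub_iff_add_eq,
          add_comm], Measure.pi_singleton]
    rfl
  rw [← Set.coe_toFinset W, ← sum_measure_singleton, ← sum_measure_singleton, Finset.mul_sum]
  refine Finset.sum_le_sum fun y _ => ?_
  rw [hsingle, hsingle]
  by_cases hex : ∃ r₀, v r₀ ≠ v' r₀
  · obtain ⟨r₀, h₀⟩ := hex
    rw [← Finset.mul_prod_erase _ _ (Finset.mem_univ r₀),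
      ← Finset.mul_prod_erase Finset.univ (fun r => bernoulliMeasure (1 : ZMod 2) 0 _ {y r - v' r})
        (Finset.mem_univ r₀), ← mul_assoc]
    refine mul_le_mul' (bernoulliMeasure_singleton_le hε _ _) (le_of_eq ?_)
    refine Finset.prod_congr rfl fun r hr => ?_
    rw [show v r = v' r by
      by_contra h
      exact (Finset.mem_erase.1 hr).1 (hv _ _ h h₀)]
  · push Not at hex
    rw [show v = v' from funext hex]
    exact le_mul_of_one_le_left (zero_le) hone

theorem isDP_sketch {u n : ℕ} {ε : ℝ} (hε : 0 < ε) {w : Fin u → ℝ} (hw : ∀ j, 0 < w j)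
    (h : Fin u → Fin n) (s : Fin u → unitInterval) :
    IsDP (fun x x' : Fin u → ZMod 2 => hammingDist x x' = 1) ε
      (fun x => (noiseDist (sketchLen u n) ε).map fun φ => (sketch w h s).mulVec x + φ) := by
  intro x x' hx W
  refine map_add_noiseDist_le hε (fun r r' hr hr' => ?_) W
  obtain ⟨j, hj⟩ := Finset.card_eq_one.1 hx
  have hdiff : ∀ i, i ≠ j → x i = x' i := by
    intro i hi
    by_contra hne
    have : i ∈ ({j} : Finset (Fin u)) := hj ▸ by simp [hne]
    exact hi (Finset.mem_singleton.1 this)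
  have hcol : ∀ r, (sketch w h s).mulVec x r ≠ (sketch w h s).mulVec x' r →
      sketch w h s r j ≠ 0 := by
    intro r hr h0
    refine hr ?_
    simp only [Matrix.mulVec, dotProduct]
    refine Finset.sum_congr rfl fun i _ => ?_
    by_cases hi : i = j
    · rw [hi, h0, zero_mul, zero_mul]
    · rw [hdiff i hi]
  have h1 := hcol r hr
  have hmem : (s j : ℝ) ∈ Set.Ioc (w j / 2 ^ ((r.divNat : ℕ) + 1)) (w j / 2 ^ (r.divNat : ℕ)) := by
    by_contra hne
    exact h1 (if_neg fun hc => hne hc.2)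
  have hind := sketch_apply_of_mem h (hw j) r.divNat hmem
  have key : ∀ r'', sketch w h s r'' j ≠ 0 → r'' = finProdFinEquiv (r.divNat, h j) := by
    intro r'' h''
    by_contra hne
    exact h'' (by rw [hind, if_neg hne])
  rw [key r h1, key r' (hcol r' hr')]

theorem mulVec_eq_list_sum {ι : Type*} {u : ℕ} (H : Matrix ι (Fin u) (ZMod 2))
    (x : Fin u → ZMod 2) {l : List (Fin u)} (hl : l.Nodup) (hx : ∀ j, j ∈ l ↔ x j ≠ 0) (r : ι) :
    (l.map (H r)).sum = H.mulVec x r := by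
  have hbit : ∀ b : ZMod 2, b ≠ 0 → b = 1 := by decide
  rw [← List.sum_toFinset _ hl, Matrix.mulVec, dotProduct]
  refine Finset.sum_subset_zero_on_sdiff (Finset.subset_univ _) (fun j hj => ?_) fun j hj => ?_
  · have : x j = 0 := by
      by_contra h
      simp [(hx j).2 h] at hj
    rw [this, mul_zero]
  · rw [hbit _ ((hx j).1 (List.mem_toFinset.1 hj)), mul_one]

/-- From `2 ^ (levels u - 1) < u` and `log 2 ≤ log u` one gets `levels u * log 2 ≤ 2 * log u`, and
`2 / log 2 < 3`. -/
theorem levels_le {u : ℕ} (hu : 2 ≤ u) : (levels u : ℝ) ≤ 3 * Real.log u := by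
  have hlog2 := Real.log_two_gt_d9
  have hpow : 2 ^ (levels u - 1) < u := Nat.pow_pred_clog_lt_self (by norm_num) hu
  have h1 : ((levels u - 1 : ℕ) : ℝ) * Real.log 2 ≤ Real.log u := by
    rw [← Real.log_pow]
    exact Real.log_le_log (by positivity) (by exact_mod_cast hpow.le)
  have h2 : Real.log 2 ≤ Real.log u :=
    Real.log_le_log (by norm_num) (by exact_mod_cast hu)
  have hL : 1 ≤ levels u := Nat.clog_pos (by norm_num) hu
  rw [Nat.cast_sub hL] at h1
  push_cast at h1
  nlinarith

theorem sketcher_correct {u n : ℕ} {ε : ℝ} (β : ℝ) (hu : 2 ≤ u) (hn : 1 ≤ n) (hε : 0 < ε)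
    {w : Fin u → ℝ} (hw : ∀ j, 0 < w j) (h : Fin u → Fin n) (s : Fin u → unitInterval)
    {x : Fin u → ZMod 2} {l : List (Fin u)} (hl : l.Nodup) (hx : ∀ j, j ∈ l ↔ x j ≠ 0)
    {C : ℝ} (hC : 57 ≤ C) :
    ∃ Y : (ℕ → unitInterval) → (Fin (sketchLen u n) → ZMod 2), Measurable Y ∧
      (∀ ω, Sketches sketcher ε β w h s l ω
        (C * ((hammingNorm x : ℝ) * Real.log u + sketchLen u n)) (Y ω)) ∧
      coinDist.map Y = (noiseDist (sketchLen u n) ε).map fun φ => (sketch w h s).mulVec x + φ := by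
  refine ⟨fun ω => (sketch w h s).mulVec x + coinNoise (sketchLen u n) (1 / (2 + ε)) ω,
    (measurable_coinNoise _ _).const_add _, fun ω => ?_, ?_⟩
  · have hlen : l.length = hammingNorm x := by
      rw [← List.toFinset_card_of_nodup hl, hammingNorm]
      congr 1
      ext j
      simp [hx]
    have hY : (sketch w h s).mulVec x + coinNoise (sketchLen u n) (1 / (2 + ε)) ω = fun r =>
        coinNoise (sketchLen u n) (1 / (2 + ε)) ω r + (l.map (sketch w h s r)).sum := by
      funext r
      rw [mulVec_eq_list_sum _ x hl hx, Pi.add_apply, add_comm]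
    simp only [hY]
    refine sketcher_spec ε β hu hw h s l ω hn ?_
    rw [hlen]
    push_cast
    -- The constant `57` is `19 * 3`: `19` steps per listed position and level, and at most `3 * log
    -- u` levels.
    have hL := levels_le hu
    have hnorm : (0 : ℝ) ≤ hammingNorm x := Nat.cast_nonneg _
    have hlog : 0 ≤ Real.log u := Real.log_natCast_nonneg u
    have hτ : (0 : ℝ) ≤ (levels u : ℝ) * n := by positivity
    have h1 := mul_le_mul_of_nonneg_left hL hnorm
    have h2 : 0 ≤ (hammingNorm x : ℝ) * Real.log u := mul_nonneg hnorm hlog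
    nlinarith
  · rw [← map_coinNoise _ hε, Measure.map_map Measurable.of_discrete (measurable_coinNoise _ _)]
    rfl

/-! ### Exponential moments -/

theorem sgn_add_one (b : ZMod 2) : sgn (b + 1) = -sgn b := by
  have : b = 0 ∨ b = 1 := by revert b; decide
  rcases this with rfl | rfl
  · simp [sgn]
  · rw [show (1 : ZMod 2) + 1 = 0 from rfl]
    simp [sgn]

theorem sgn_sq (b : ZMod 2) : sgn b ^ 2 = 1 := by
  unfold sgn
  split_ifs <;> norm_num

theorem abs_sgn (b : ZMod 2) : |sgn b| = 1 := by
  unfold sgn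
  split_ifs <;> norm_num

theorem exp_le_quadratic {x : ℝ} (hx : |x| ≤ 1) : Real.exp x ≤ 1 + x + x ^ 2 := by
  have := (abs_le.1 (Real.abs_exp_sub_one_sub_id_le hx)).2
  linarith

theorem sum_sgn_add_single {n : ℕ} (z : Fin n → ZMod 2) (k : Fin n) :
    ∑ k', sgn ((z + Pi.single k 1 : Fin n → ZMod 2) k') = ∑ k', sgn (z k') - 2 * sgn (z k) := by
  rw [← Finset.add_sum_erase _ _ (Finset.mem_univ k),
    ← Finset.add_sum_erase Finset.univ (fun k' => sgn (z k')) (Finset.mem_univ k)]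
  have : ∀ k' ∈ Finset.univ.erase k, sgn ((z + Pi.single k 1 : Fin n → ZMod 2) k') = sgn (z k') := by
    intro k' hk'
    rw [Pi.add_apply, Pi.single_eq_of_ne (Finset.mem_erase.1 hk').1, add_zero]
  rw [Finset.sum_congr rfl this, Pi.add_apply, Pi.single_eq_same, sgn_add_one]
  ring

/-- Flipping a uniformly random sign with probability `a`. -/
theorem exp_flip_le {n : ℕ} (hn : 1 ≤ n) (z : Fin n → ZMod 2) {a μ : ℝ} (ha : 0 ≤ a)
    (hμ : |μ| ≤ 1 / 2) :
    (1 - a) * Real.exp (μ * ∑ k, sgn (z k)) +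
        a * ((∑ k, Real.exp (μ * ∑ k', sgn ((z + Pi.single k 1 : Fin n → ZMod 2) k'))) / n) ≤
      Real.exp (μ * (∑ k, sgn (z k)) * (1 - 2 * a / n) + 4 * a * μ ^ 2) := by
  have hn0 : (0 : ℝ) < n := by exact_mod_cast hn
  set S := ∑ k, sgn (z k) with hS
  -- Flipping entry `k` lowers the sum by `2 * sgn (z k)`, and `|2 * μ| ≤ 1` permits the quadratic
  -- bound on the exponential. Averaging over `k` then turns the individual signs back into `S / n`.
  have hterm : ∀ k, Real.exp (μ * ∑ k', sgn ((z + Pi.single k 1 : Fin n → ZMod 2) k')) ≤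
      Real.exp (μ * S) * (1 - 2 * μ * sgn (z k) + 4 * μ ^ 2) := by
    intro k
    rw [sum_sgn_add_single, ← hS, mul_sub, sub_eq_add_neg, Real.exp_add]
    refine mul_le_mul_of_nonneg_left ?_ (Real.exp_pos _).le
    refine (exp_le_quadratic ?_).trans (le_of_eq ?_)
    · rw [abs_neg, abs_mul, abs_mul, abs_sgn, abs_two]
      linarith
    · linear_combination 4 * μ ^ 2 * sgn_sq (z k)
  have hsum : (∑ k, Real.exp (μ * ∑ k', sgn ((z + Pi.single k 1 : Fin n → ZMod 2) k'))) / n ≤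
      Real.exp (μ * S) * (1 - 2 * μ * S / n + 4 * μ ^ 2) := by
    rw [div_le_iff₀ hn0]
    refine (Finset.sum_le_sum fun k _ => hterm k).trans (le_of_eq ?_)
    rw [← Finset.mul_sum, Finset.sum_add_distrib, Finset.sum_sub_distrib, ← Finset.mul_sum, ← hS]
    simp
    field_simp
  calc _ ≤ (1 - a) * Real.exp (μ * S) +
        a * (Real.exp (μ * S) * (1 - 2 * μ * S / n + 4 * μ ^ 2)) := by gcongr
    _ = Real.exp (μ * S) * (a * (-2 * μ * S / n + 4 * μ ^ 2) + 1) := by ring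
    _ ≤ Real.exp (μ * S) * Real.exp (a * (-2 * μ * S / n + 4 * μ ^ 2)) :=
        mul_le_mul_of_nonneg_left (Real.add_one_le_exp _) (Real.exp_pos _).le
    _ = _ := by
        rw [← Real.exp_add]
        congr 1
        ring

/-- The law of the pair of hash values of a position. -/
noncomputable abbrev hashDist (n : ℕ) : Measure (Fin n × unitInterval) :=
  (uniformOn (Set.univ : Set (Fin n))).prod volume

open Classical in
/-- The unit vector at the first hash value, if the second one lies in `A`. -/
noncomputable def hit {n : ℕ} (A : Set unitInterval) (p : Fin n × unitInterval) : Fin n → ZMod 2 :=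
  if p.2 ∈ A then Pi.single p.1 1 else 0

/-- Splitting according to whether the second hash value lies in `A` reduces this to `exp_flip_le`
with `a` the volume of `A`. -/
theorem lintegral_hit_le {n : ℕ} (hn : 1 ≤ n) {A : Set unitInterval} (hA : MeasurableSet A)
    (z : Fin n → ZMod 2) {μ : ℝ} (hμ : |μ| ≤ 1 / 2) :
    ∫⁻ p, ENNReal.ofReal (Real.exp (μ * ∑ k, sgn ((z + hit A p) k))) ∂hashDist n ≤
      ENNReal.ofReal (Real.exp (μ * (∑ k, sgn (z k)) * (1 - 2 * volume.real A / n) +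
        4 * volume.real A * μ ^ 2)) := by
  classical
  have : Nonempty (Fin n) := ⟨⟨0, hn⟩⟩
  have : IsProbabilityMeasure (uniformOn (Set.univ : Set (Fin n))) :=
    isProbabilityMeasure_uniformOn Set.finite_univ Set.univ_nonempty
  set a := (volume : Measure unitInterval).real A with ha
  have hn0 : (0 : ℝ) < n := by exact_mod_cast hn
  set F0 := Real.exp (μ * ∑ k, sgn (z k)) with hF0
  set F : Fin n → ℝ := fun k => Real.exp (μ * ∑ k', sgn ((z + Pi.single k 1 : Fin n → ZMod 2) k')) with hF
  have hval : ∀ p : Fin n × unitInterval,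
      ENNReal.ofReal (Real.exp (μ * ∑ k, sgn ((z + hit A p) k))) =
        A.indicator (fun _ => ENNReal.ofReal (F p.1)) p.2 +
          Aᶜ.indicator (fun _ => ENNReal.ofReal F0) p.2 := by
    intro p
    by_cases hp : p.2 ∈ A <;> simp [hit, hp, hF, hF0]
  have ha1 : a ≤ 1 := measureReal_le_one
  have ha0 : 0 ≤ a := measureReal_nonneg
  have hvA : (volume : Measure unitInterval) A = ENNReal.ofReal a := (ofReal_measureReal).symm
  have hvAc : (volume : Measure unitInterval) Aᶜ = ENNReal.ofReal (1 - a) := by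
    rw [← ofReal_measureReal, probReal_compl_eq_one_sub hA]
  have huni : ∀ k : Fin n, uniformOn (Set.univ : Set (Fin n)) {k} = ENNReal.ofReal (1 / n) := by
    intro k
    rw [uniformOn_univ, Measure.count_singleton, Fintype.card_fin,
      ENNReal.ofReal_div_of_pos hn0, ENNReal.ofReal_one, ENNReal.ofReal_natCast]
  have hFp : ∀ k, 0 ≤ F k := fun k => (Real.exp_pos _).le
  have hmeas : Measurable fun p : Fin n × unitInterval =>
      A.indicator (fun _ => ENNReal.ofReal (F p.1)) p.2 +
          Aᶜ.indicator (fun _ => ENNReal.ofReal F0) p.2 := by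
    refine Measurable.add ?_ ?_
    · have : (fun p : Fin n × unitInterval => A.indicator (fun _ => ENNReal.ofReal (F p.1)) p.2) =
        (Prod.snd ⁻¹' A).indicator fun p => ENNReal.ofReal (F p.1) := by
        ext p
        by_cases hp : p.2 ∈ A <;> simp [hp]
      rw [this]
      exact Measurable.indicator ((Measurable.of_discrete (f := fun k =>
        ENNReal.ofReal (F k))).comp measurable_fst) (measurable_snd hA)
    · exact (measurable_const.indicator hA.compl).comp measurable_snd
  simp_rw [hval]
  rw [lintegral_prod _ hmeas.aemeasurable]
  have hinner : ∀ k : Fin n, ∫⁻ s, (A.indicator (fun _ => ENNReal.ofReal (F k)) s +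
      Aᶜ.indicator (fun _ => ENNReal.ofReal F0) s) ∂(volume : Measure unitInterval) =
      ENNReal.ofReal (F k * a + F0 * (1 - a)) := by
    intro k
    rw [lintegral_add_left (measurable_const.indicator hA), lintegral_indicator_const hA,
      lintegral_indicator_const hA.compl, hvA, hvAc, ← ENNReal.ofReal_mul (hFp k),
      ← ENNReal.ofReal_mul (Real.exp_pos _).le, ENNReal.ofReal_add
        (mul_nonneg (hFp k) ha0) (mul_nonneg (Real.exp_pos _).le (by linarith))]
  simp_rw [hinner]
  rw [lintegral_fintype]
  simp_rw [huni]
  have hnn : ∀ k, 0 ≤ F k * a + F0 * (1 - a) := fun k =>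
    add_nonneg (mul_nonneg (hFp k) ha0) (mul_nonneg (Real.exp_pos _).le (by linarith))
  simp_rw [← ENNReal.ofReal_mul (hnn _)]
  rw [← ENNReal.ofReal_sum_of_nonneg fun k _ => mul_nonneg (hnn k) (by positivity)]
  refine ENNReal.ofReal_le_ofReal (le_trans (le_of_eq ?_) (exp_flip_le hn z ha0 hμ))
  rw [← Finset.sum_mul, Finset.sum_add_distrib, ← Finset.sum_mul]
  simp only [Finset.sum_const, Finset.card_univ, Fintype.card_fin, nsmul_eq_mul]
  field_simp
  ring

/-- Induction over positions, for all starting vectors `z`. The inner integral over the later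
positions turns `lam` into `lam * q`, with `q` the product of their factors; the first position is
then integrated with this smaller parameter. Its error `4 * a * (lam * q) ^ 2` fits the telescoping
identity `(1 - q ^ 2) + q ^ 2 * (1 - f ^ 2) = 1 - (q * f) ^ 2` for `f = 1 - 2 * a / n`. The closed
form keeps the total error independent of the number of positions. -/
theorem lintegral_hits_le {n : ℕ} (hn : 1 ≤ n) {lam : ℝ} (hlam : |lam| ≤ 1 / 2) :
    ∀ {u : ℕ} {A : Fin u → Set unitInterval}, (∀ j, MeasurableSet (A j)) →
      (∀ j, volume.real (A j) ≤ 1 / 2) → ∀ z : Fin n → ZMod 2,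
      ∫⁻ p, ENNReal.ofReal (Real.exp (lam * ∑ k, sgn ((z + ∑ j, hit (A j) (p j)) k)))
          ∂(Measure.pi fun _ : Fin u => hashDist n) ≤
        ENNReal.ofReal (Real.exp (lam * (∑ k, sgn (z k)) *
            (∏ j, (1 - 2 * volume.real (A j) / n)) +
          2 * lam ^ 2 * n * (1 - (∏ j, (1 - 2 * volume.real (A j) / n)) ^ 2))) := by
  have : Nonempty (Fin n) := ⟨⟨0, hn⟩⟩
  have : IsProbabilityMeasure (uniformOn (Set.univ : Set (Fin n))) :=
    isProbabilityMeasure_uniformOn Set.finite_univ Set.univ_nonempty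
  have hn1 : (1 : ℝ) ≤ n := by exact_mod_cast hn
  have hmeashit : ∀ {A : Set unitInterval}, MeasurableSet A →
      Measurable (hit A : Fin n × unitInterval → _) := by
    classical
    intro A hA
    exact Measurable.ite (measurable_snd hA)
      ((Measurable.of_discrete (f := fun k : Fin n => (Pi.single k 1 : Fin n → ZMod 2))).comp
        measurable_fst) measurable_const
  intro u
  induction u with
  | zero =>
    intro A _ _ z
    simp
  | succ u ih =>
    intro A hA hA2 z
    set q := ∏ j : Fin u, (1 - 2 * volume.real (A j.succ) / n) with hq
    have hfac : ∀ j, 0 ≤ 1 - 2 * volume.real (A j) / n ∧ 1 - 2 * volume.real (A j) / n ≤ 1 := by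
      intro j
      have h0 : 0 ≤ volume.real (A j) := measureReal_nonneg
      refine ⟨?_, ?_⟩
      · rw [sub_nonneg, div_le_one (by linarith)]
        linarith [hA2 j]
      · have : 0 ≤ 2 * volume.real (A j) / n := by positivity
        linarith
    have hq0 : 0 ≤ q := Finset.prod_nonneg fun j _ => (hfac _).1
    have hq1 : q ≤ 1 := Finset.prod_le_one (fun j _ => (hfac _).1) fun j _ => (hfac _).2
    have hmp := (measurePreserving_piFinSuccAbove (fun _ : Fin (u + 1) => hashDist n) 0).symm
    rw [← hmp.lintegral_comp_emb (MeasurableEquiv.measurableEmbedding _)]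
    have hmeas : Measurable fun p : (Fin n × unitInterval) × (Fin u → Fin n × unitInterval) =>
        ENNReal.ofReal (Real.exp (lam * ∑ k, sgn ((z + hit (A 0) p.1 +
          ∑ j : Fin u, hit (A j.succ) (p.2 j)) k))) := by
      refine (Measurable.of_discrete (f := fun v : Fin n → ZMod 2 =>
        ENNReal.ofReal (Real.exp (lam * ∑ k, sgn (v k))))).comp ?_
      refine Measurable.add (((hmeashit (hA 0)).comp measurable_fst).const_add z) ?_
      refine Finset.measurable_sum _ fun j _ => ?_
      exact (hmeashit (hA _)).comp ((measurable_pi_apply j).comp measurable_snd)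
    have heq : ∀ p : (Fin n × unitInterval) × (Fin u → Fin n × unitInterval),
        z + ∑ j, hit (A j) ((MeasurableEquiv.piFinSuccAbove (fun _ => Fin n × unitInterval) 0).symm
          p j) = z + hit (A 0) p.1 + ∑ j : Fin u, hit (A j.succ) (p.2 j) := by
      intro p
      rw [Fin.sum_univ_succ, ← add_assoc]
      rfl
    simp_rw [heq]
    rw [lintegral_prod _ hmeas.aemeasurable]
    have hqlam : |lam * q| ≤ 1 / 2 := by
      rw [abs_mul, abs_of_nonneg hq0]
      nlinarith [abs_nonneg lam]
    calc _ ≤ ∫⁻ p, ENNReal.ofReal (Real.exp (2 * lam ^ 2 * n * (1 - q ^ 2))) *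
            ENNReal.ofReal (Real.exp (lam * q * ∑ k, sgn ((z + hit (A 0) p) k))) ∂hashDist n := by
          refine lintegral_mono fun p => ?_
          refine (ih (fun j => hA j.succ) (fun j => hA2 j.succ) (z + hit (A 0) p)).trans
            (le_of_eq ?_)
          rw [← ENNReal.ofReal_mul (Real.exp_pos _).le, ← Real.exp_add]
          congr 2
          ring
      _ ≤ ENNReal.ofReal (Real.exp (2 * lam ^ 2 * n * (1 - q ^ 2))) *
            ENNReal.ofReal (Real.exp (lam * q * (∑ k, sgn (z k)) *
              (1 - 2 * volume.real (A 0) / n) + 4 * volume.real (A 0) * (lam * q) ^ 2)) := by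
          rw [lintegral_const_mul']
          · exact mul_le_mul_right (lintegral_hit_le hn (hA 0) z hqlam) _
          · exact ENNReal.ofReal_ne_top
      _ ≤ _ := by
          rw [← ENNReal.ofReal_mul (Real.exp_pos _).le, ← Real.exp_add, Fin.prod_univ_succ, ← hq]
          refine ENNReal.ofReal_le_ofReal (Real.exp_le_exp.2 ?_)
          set a := (volume : Measure unitInterval).real (A 0)
          have ha0 : 0 ≤ a := measureReal_nonneg
          have ha2 : a ≤ 1 / 2 := hA2 0
          -- The right side equals `8 * a - 8 * a ^ 2 / n`, and `a / n ≤ 1 / 2`; this is where the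
          -- volume bound `1 / 2` enters.
          have key : 4 * a ≤ 2 * n * (1 - (1 - 2 * a / n) ^ 2) := by
            have : 2 * n * (1 - (1 - 2 * a / n) ^ 2) = 8 * a - 8 * a * (a / n) := by
              field_simp
              ring
            rw [this]
            have : a / n ≤ 1 / 2 := by
              rw [div_le_iff₀ (by linarith)]
              linarith
            nlinarith
          have := mul_le_mul_of_nonneg_left key (by positivity : 0 ≤ lam ^ 2 * q ^ 2)
          nlinarith

theorem lintegral_pi_prod {ι α : Type*} [Fintype ι] [DecidableEq ι] [Fintype α]
    [MeasurableSpace α] [MeasurableSingletonClass α] (μ : ι → Measure α) [∀ i, SigmaFinite (μ i)]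
    (f : ι → α → ENNReal) :
    ∫⁻ φ, ∏ i, f i (φ i) ∂Measure.pi μ = ∏ i, ∫⁻ b, f i b ∂μ i := by
  simp_rw [lintegral_fintype, Measure.pi_singleton, ← Finset.prod_mul_distrib,
    Finset.prod_univ_sum, Fintype.piFinset_univ]

/-- The expected sign of a noise bit is `(1 + ε) / (2 + ε) - 1 / (2 + ε) = ε / (2 + ε)`, and
independence gives a product over entries. The coefficients `c` vary with the entry so that a single
level can be selected. -/
theorem lintegral_noise_le {τ : ℕ} {ε : ℝ} (hε : 0 < ε) (v : Fin τ → ZMod 2) {c : Fin τ → ℝ}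
    (hc : ∀ r, |c r| ≤ 1) :
    ∫⁻ φ, ENNReal.ofReal (Real.exp (∑ r, c r * sgn ((v + φ) r))) ∂noiseDist τ ε ≤
      ENNReal.ofReal (Real.exp (∑ r, (ε / (2 + ε) * (c r * sgn (v r)) + c r ^ 2))) := by
  simp_rw [Pi.add_apply, Real.exp_sum, ENNReal.ofReal_prod_of_nonneg fun _ _ => (Real.exp_pos _).le]
  rw [noiseDist, lintegral_pi_prod _ fun (r : Fin τ) b =>
    ENNReal.ofReal (Real.exp (c r * sgn (v r + b)))]
  refine Finset.prod_le_prod' fun r _ => ?_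
  rw [lintegral_fintype, show (Finset.univ : Finset (ZMod 2)) = {0, 1} from rfl,
    Finset.sum_pair (by decide), noise_singleton hε, noise_singleton hε, if_neg (by decide),
    if_pos rfl, add_zero, sgn_add_one, ← ENNReal.ofReal_mul (Real.exp_pos _).le,
    ← ENNReal.ofReal_mul (Real.exp_pos _).le, ← ENNReal.ofReal_add (by positivity) (by positivity)]
  refine ENNReal.ofReal_le_ofReal ?_
  have habs : |c r * sgn (v r)| ≤ 1 := by rw [abs_mul, abs_sgn, mul_one]; exact hc r
  have hsq : (c r * sgn (v r)) ^ 2 = c r ^ 2 := by rw [mul_pow, sgn_sq, mul_one]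
  have h1 := exp_le_quadratic habs
  have h2 := exp_le_quadratic ((abs_neg _).trans_le habs)
  rw [mul_neg]
  rw [neg_sq] at h2
  rw [hsq] at h1 h2
  generalize c r * sgn (v r) = y at *
  have h3 := Real.add_one_le_exp (ε / (2 + ε) * y + c r ^ 2)
  have h4 : 0 < 2 + ε := by linarith
  calc Real.exp y * ((1 + ε) / (2 + ε)) + Real.exp (-y) * (1 / (2 + ε))
      ≤ (1 + y + c r ^ 2) * ((1 + ε) / (2 + ε)) + (1 + -y + c r ^ 2) * (1 / (2 + ε)) := by gcongr
    _ = ε / (2 + ε) * y + c r ^ 2 + 1 := by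
        field_simp
        ring
    _ ≤ _ := h3

/-! ### Concentration of the level statistics -/

instance {m k α : Type*} [Finite m] [Finite k] [Countable α] [MeasurableSpace α]
    [DiscreteMeasurableSpace α] : DiscreteMeasurableSpace (Matrix m k α) :=
  inferInstanceAs (DiscreteMeasurableSpace (m → k → α))

/-- The expected sign of an entry of level `i` of a noiseless sketch. -/
noncomputable def meanSign {u : ℕ} (n : ℕ) (w : Fin u → ℝ) (x : Fin u → ZMod 2) (i : ℕ) : ℝ :=
  ∏ j, (1 - ((x j).val : ℝ) * w j / (n * 2 ^ i))

theorem measurable_sketch {u n : ℕ} (w : Fin u → ℝ) :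
    Measurable fun hs : (Fin u → Fin n) × (Fin u → unitInterval) => sketch w hs.1 hs.2 := by
  classical
  refine measurable_pi_lambda _ fun r => measurable_pi_lambda _ fun j => ?_
  unfold sketch
  refine Measurable.ite ?_ measurable_const measurable_const
  refine MeasurableSet.inter ?_ ?_
  · exact measurableSet_eq_fun ((measurable_pi_apply j).comp measurable_fst) measurable_const
  · exact (measurable_subtype_coe.comp ((measurable_pi_apply j).comp measurable_snd))
      measurableSet_Ioc

instance {u n : ℕ} [NeZero n] : IsProbabilityMeasure
    (uniformOn (Set.univ : Set (Fin u → Fin n))) :=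
  isProbabilityMeasure_uniformOn Set.finite_univ Set.univ_nonempty

instance {n : ℕ} [NeZero n] : IsProbabilityMeasure (uniformOn (Set.univ : Set (Fin n))) :=
  isProbabilityMeasure_uniformOn Set.finite_univ Set.univ_nonempty

instance {u n : ℕ} [NeZero n] (w : Fin u → ℝ) : IsProbabilityMeasure (sketchDist n w) :=
  Measure.isProbabilityMeasure_map (measurable_sketch w).aemeasurable

instance {τ : ℕ} (ε : ℝ) : IsProbabilityMeasure (noiseDist τ ε) := by
  unfold noiseDist
  infer_instance

/-- Regroups the two hash functions into one independent pair of hash values per position, the form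
needed for the induction over positions. -/
theorem lintegral_sketchDist {u n : ℕ} [NeZero n] (w : Fin u → ℝ)
    (F : Matrix (Fin (sketchLen u n)) (Fin u) (ZMod 2) → ENNReal) :
    ∫⁻ H, F H ∂sketchDist n w =
      ∫⁻ p, F (sketch w (fun j => (p j).1) fun j => (p j).2)
        ∂(Measure.pi fun _ : Fin u => hashDist n) := by
  have hmp := measurePreserving_arrowProdEquivProdArrow (Fin n) unitInterval (Fin u)
    (fun _ => uniformOn Set.univ) (fun _ => volume)
  rw [sketchDist, lintegral_map Measurable.of_discrete (measurable_sketch w),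
    ← Set.pi_univ Set.univ, uniformOn_pi, ← hmp.lintegral_comp_emb
      (MeasurableEquiv.measurableEmbedding _)]
  rfl

/-- The values of the second hash function that put a position into level `i`. -/
def levelSet (b : ZMod 2) (w : ℝ) (i : ℕ) : Set unitInterval :=
  if b = 0 then ∅ else Subtype.val ⁻¹' Set.Ioc (w / 2 ^ (i + 1)) (w / 2 ^ i)

theorem measurableSet_levelSet (b : ZMod 2) (w : ℝ) (i : ℕ) : MeasurableSet (levelSet b w i) := by
  unfold levelSet
  split_ifs
  · exact MeasurableSet.empty
  · exact measurable_subtype_coe measurableSet_Ioc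

theorem volume_levelSet (b : ZMod 2) {w : ℝ} (hw : 0 < w) (hw1 : w ≤ 1) (i : ℕ) :
    volume.real (levelSet b w i) = b.val * w / 2 ^ (i + 1) := by
  have hb : b = 0 ∨ b = 1 := by revert b; decide
  rcases hb with rfl | rfl
  · simp [levelSet]
  · have hmem : ∀ k : ℕ, w / 2 ^ k ∈ unitInterval := fun k =>
      ⟨by positivity, (div_le_self hw.le (one_le_pow₀ (by norm_num))).trans hw1⟩
    have : levelSet 1 w i = Set.Ioc (⟨_, hmem (i + 1)⟩ : unitInterval) ⟨_, hmem i⟩ := by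
      ext s
      simp [levelSet, ← Subtype.coe_lt_coe, ← Subtype.coe_le_coe]
    rw [this, Measure.real, unitInterval.volume_Ioc, ENNReal.toReal_ofReal]
    · simp only [show ZMod.val (1 : ZMod 2) = 1 from rfl, pow_succ]
      push_cast
      field_simp
      ring
    · rw [sub_nonneg]
      exact div_le_div_of_nonneg_left hw.le (by positivity)
        (pow_le_pow_right₀ (by norm_num) (Nat.le_succ i))

theorem sum_divNat_eq {L n : ℕ} (i : Fin L) (f : Fin (L * n) → ℝ) :
    ∑ r, (if r.divNat = i then f r else 0) = ∑ k, f (finProdFinEquiv (i, k)) := by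
  rw [← finProdFinEquiv.sum_comp, Fintype.sum_prod_type]
  have : ∀ (i' : Fin L) (k : Fin n), (finProdFinEquiv (i', k)).divNat = i' := fun i' k =>
    congrArg Prod.fst (finProdFinEquiv.symm_apply_apply (i', k))
  simp_rw [this]
  rw [Finset.sum_eq_single i]
  · simp
  · intro i' _ hi'
    simp [hi']
  · simp

/-- Positions with `x j = 0` have an empty level set, so the sum can run over all positions. -/
theorem sketch_mulVec_apply {u n : ℕ} (w : Fin u → ℝ) (x : Fin u → ZMod 2)
    (p : Fin u → Fin n × unitInterval) (i : Fin (levels u)) (k : Fin n) :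
    (sketch w (fun j => (p j).1) fun j => (p j).2).mulVec x (finProdFinEquiv (i, k)) =
      (∑ j, hit (levelSet (x j) (w j) i) (p j)) k := by
  classical
  have h1 : (finProdFinEquiv (i, k)).divNat = i := congrArg Prod.fst
    (finProdFinEquiv.symm_apply_apply (i, k))
  have h2 : (finProdFinEquiv (i, k)).modNat = k := congrArg Prod.snd
    (finProdFinEquiv.symm_apply_apply (i, k))
  rw [Finset.sum_apply, Matrix.mulVec, dotProduct]
  refine Finset.sum_congr rfl fun j _ => ?_
  have hx : x j = 0 ∨ x j = 1 := by generalize x j = b; revert b; decide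
  simp only [sketch, h1, h2]
  rcases hx with hx | hx
  · simp [hx, levelSet, hit]
  · by_cases hs : ((p j).2 : ℝ) ∈ Set.Ioc (w j / 2 ^ ((i : ℕ) + 1)) (w j / 2 ^ (i : ℕ))
    · have hh : hit (levelSet (x j) (w j) i) (p j) = Pi.single (p j).1 1 :=
        if_pos (by simpa [hx, levelSet] using hs)
      rw [hh, Pi.single_apply]
      simp only [hs, and_true, hx, mul_one, eq_comm]
    · have hh : hit (levelSet (x j) (w j) i) (p j) = 0 :=
        if_neg (by simpa [hx, levelSet] using hs)
      simp only [hh, hs, and_false, if_false, zero_mul, Pi.zero_apply]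

/-- For a fixed sketch the noise rescales `lam` by `ρ` at a cost of `lam ^ 2 * n`. Integrating the
hash values with parameter `lam * ρ`, starting from the zero vector with sum of signs `n`, costs at
most `2 * lam ^ 2 * n` more. -/
theorem lintegral_exp_level_le {u n : ℕ} [NeZero n] {ε : ℝ} (hε : 0 < ε) {w : Fin u → ℝ}
    (hw : ∀ j, 0 < w j ∧ w j ≤ 1) (x : Fin u → ZMod 2) (i : Fin (levels u)) {lam : ℝ}
    (hlam : |lam| ≤ 1 / 2) :
    ∫⁻ Hφ, ENNReal.ofReal (Real.exp (lam * ∑ k : Fin n,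
        sgn ((Hφ.1.mulVec x + Hφ.2) (finProdFinEquiv (i, k)))))
        ∂((sketchDist n w).prod (noiseDist (sketchLen u n) ε)) ≤
      ENNReal.ofReal (Real.exp (lam * (ε / (2 + ε) * n * meanSign n w x i) + 3 * lam ^ 2 * n)) := by
  have hn : 1 ≤ n := Nat.one_le_iff_ne_zero.2 (NeZero.ne n)
  have hn0 : (0 : ℝ) < n := by exact_mod_cast hn
  set ρ := ε / (2 + ε) with hρ
  have hρ0 : 0 ≤ ρ := by positivity
  have hρ1 : ρ ≤ 1 := by rw [hρ, div_le_one (by positivity)]; linarith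
  rw [lintegral_prod _ Measurable.of_discrete.aemeasurable]
  have hinner : ∀ H : Matrix (Fin (sketchLen u n)) (Fin u) (ZMod 2),
      ∫⁻ φ, ENNReal.ofReal (Real.exp (lam * ∑ k : Fin n,
        sgn ((H.mulVec x + φ) (finProdFinEquiv (i, k))))) ∂(noiseDist (sketchLen u n) ε) ≤
      ENNReal.ofReal (Real.exp (lam ^ 2 * n)) * ENNReal.ofReal (Real.exp (lam * ρ * ∑ k : Fin n,
        sgn (H.mulVec x (finProdFinEquiv (i, k))))) := by
    intro H
    have := lintegral_noise_le hε (H.mulVec x) (c := fun r => if r.divNat = i then lam else 0)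
      (fun r => by
        split_ifs
        · linarith
        · simp)
    simp only [ite_mul, zero_mul, ite_pow, ne_eq, OfNat.ofNat_ne_zero, not_false_eq_true, zero_pow,
      mul_ite, mul_zero, Finset.sum_add_distrib, sum_divNat_eq, ← Finset.mul_sum] at this
    refine this.trans (le_of_eq ?_)
    rw [← ENNReal.ofReal_mul (Real.exp_pos _).le, ← Real.exp_add]
    congr 2
    simp
    ring
  refine (lintegral_mono hinner).trans ?_
  rw [lintegral_const_mul' _ _ ENNReal.ofReal_ne_top, lintegral_sketchDist]
  simp_rw [sketch_mulVec_apply]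
  have hlamρ : |lam * ρ| ≤ 1 / 2 := by
    rw [abs_mul, abs_of_nonneg hρ0]
    nlinarith [abs_nonneg lam]
  have hA2 : ∀ j, volume.real (levelSet (x j) (w j) i) ≤ 1 / 2 := by
    intro j
    rw [volume_levelSet _ (hw j).1 (hw j).2]
    have hx : ((x j).val : ℝ) ≤ 1 := by exact_mod_cast Nat.lt_succ_iff.1 (ZMod.val_lt (x j))
    have h2 : (2 : ℝ) ≤ 2 ^ ((i : ℕ) + 1) := by
      rw [pow_succ]
      linarith [one_le_pow₀ (M₀ := ℝ) (a := 2) (by norm_num) (n := i)]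
    rw [div_le_iff₀ (by positivity)]
    nlinarith [(hw j).1, (hw j).2]
  have hmain := lintegral_hits_le hn hlamρ (A := fun j => levelSet (x j) (w j) i)
    (fun j => measurableSet_levelSet _ _ _) hA2 0
  simp only [zero_add] at hmain
  refine (mul_le_mul_right hmain _).trans ?_
  rw [← ENNReal.ofReal_mul (Real.exp_pos _).le, ← Real.exp_add]
  refine ENNReal.ofReal_le_ofReal (Real.exp_le_exp.2 ?_)
  have hprod : ∏ j, (1 - 2 * volume.real (levelSet (x j) (w j) i) / n) = meanSign n w x i := by
    refine Finset.prod_congr rfl fun j _ => ?_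
    rw [volume_levelSet _ (hw j).1 (hw j).2, pow_succ]
    field_simp
  rw [hprod]
  have hsum : ∑ k : Fin n, sgn ((0 : Fin n → ZMod 2) k) = n := by simp [sgn]
  rw [hsum]
  have h1 : ρ ^ 2 ≤ 1 := pow_le_one₀ hρ0 hρ1
  have h2 : ρ ^ 2 * (1 - meanSign n w x i ^ 2) ≤ 1 := by
    nlinarith [sq_nonneg ρ, sq_nonneg (ρ * meanSign n w x i)]
  have h3 := mul_le_mul_of_nonneg_left h2 (by positivity : 0 ≤ 2 * lam ^ 2 * n)
  nlinarith

theorem measure_level_ge_le {u n : ℕ} [NeZero n] {ε : ℝ} (hε : 0 < ε) {w : Fin u → ℝ}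
    (hw : ∀ j, 0 < w j ∧ w j ≤ 1) (x : Fin u → ZMod 2) (i : Fin (levels u)) {σ δ : ℝ}
    (hσ : |σ| = 1) (hδ : 0 ≤ δ) (hδ3 : δ ≤ 3) :
    ((sketchDist n w).prod (noiseDist (sketchLen u n) ε))
      {Hφ | δ * n ≤ σ * (∑ k : Fin n, sgn ((Hφ.1.mulVec x + Hφ.2) (finProdFinEquiv (i, k))) -
        ε / (2 + ε) * n * meanSign n w x i)} ≤ ENNReal.ofReal (Real.exp (-(n * δ ^ 2 / 12))) := by
  set π := (sketchDist n w).prod (noiseDist (sketchLen u n) ε)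
  set m := ε / (2 + ε) * n * meanSign n w x i
  set T : Matrix (Fin (sketchLen u n)) (Fin u) (ZMod 2) × (Fin (sketchLen u n) → ZMod 2) → ℝ :=
    fun Hφ => ∑ k : Fin n, sgn ((Hφ.1.mulVec x + Hφ.2) (finProdFinEquiv (i, k)))
  have hσ2 : σ ^ 2 = 1 := by rw [← sq_abs, hσ, one_pow]
  -- The parameter `δ / 6` minimizes `3 * lam ^ 2 * n - lam * δ * n`, with value `-n * δ ^ 2 / 12`;
  -- `δ ≤ 3` keeps it in the admissible range. The sign `σ` treats both tails at once.
  have hlam : |σ * (δ / 6)| ≤ 1 / 2 := by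
    rw [abs_mul, hσ, abs_of_nonneg (by positivity)]
    linarith
  have hM := lintegral_exp_level_le (n := n) hε hw x i hlam
  have hmarkov := mul_meas_ge_le_lintegral (μ := π)
    (f := fun Hφ => ENNReal.ofReal (Real.exp (σ * (δ / 6) * T Hφ))) Measurable.of_discrete
    (ENNReal.ofReal (Real.exp (δ / 6 * (δ * n + σ * m))))
  have hsub : {Hφ | δ * n ≤ σ * (T Hφ - m)} ⊆
      {Hφ | ENNReal.ofReal (Real.exp (δ / 6 * (δ * n + σ * m))) ≤
        ENNReal.ofReal (Real.exp (σ * (δ / 6) * T Hφ))} := by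
    intro Hφ hH
    refine ENNReal.ofReal_le_ofReal (Real.exp_le_exp.2 ?_)
    have := mul_le_mul_of_nonneg_left (show δ * n ≤ σ * (T Hφ - m) from hH)
      (by positivity : 0 ≤ δ / 6)
    nlinarith
  refine (measure_mono hsub).trans ?_
  rw [mul_comm] at hmarkov
  have hpos : ENNReal.ofReal (Real.exp (δ / 6 * (δ * n + σ * m))) ≠ 0 := by
    simp [Real.exp_pos]
  refine (ENNReal.le_div_iff_mul_le (Or.inl hpos) (Or.inl ENNReal.ofReal_ne_top)).2
    (hmarkov.trans hM) |>.trans ?_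
  rw [← ENNReal.ofReal_div_of_pos (Real.exp_pos _), ← Real.exp_sub]
  refine ENNReal.ofReal_le_ofReal (Real.exp_le_exp.2 (le_of_eq ?_))
  linear_combination (3 * (δ / 6) ^ 2 * n) * hσ2

/-- A deviation `η` of a statistic is a deviation `ε / (2 + ε) * η * n` of the sum of signs; the
bound is a union over the levels and the two tails. -/
theorem levelStat_concentration {u n : ℕ} [NeZero n] {ε : ℝ} (hε : 0 < ε) {w : Fin u → ℝ}
    (hw : ∀ j, 0 < w j ∧ w j ≤ 1) (x : Fin u → ZMod 2) {η : ℝ} (hη : 0 ≤ η) (hη1 : η ≤ 1) :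
    1 - 2 * levels u * Real.exp (-(n * (ε / (2 + ε) * η) ^ 2 / 12)) ≤
      ((sketchDist n w).prod (noiseDist (sketchLen u n) ε)).real
        {Hφ | ∀ i, |levelStat ε (Hφ.1.mulVec x + Hφ.2) i - meanSign n w x i| < η} := by
  have hn0 : (0 : ℝ) < n := by exact_mod_cast Nat.pos_of_ne_zero (NeZero.ne n)
  set π := (sketchDist n w).prod (noiseDist (sketchLen u n) ε)
  set G := {Hφ : Matrix (Fin (sketchLen u n)) (Fin u) (ZMod 2) × (Fin (sketchLen u n) → ZMod 2) |
    ∀ i, |levelStat ε (Hφ.1.mulVec x + Hφ.2) i - meanSign n w x i| < η}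
  have hρ0 : 0 < ε / (2 + ε) := by positivity
  have hρ1 : ε / (2 + ε) ≤ 1 := by rw [div_le_one (by positivity)]; linarith
  have hδ3 : ε / (2 + ε) * η ≤ 3 := by nlinarith
  set B : ℝ → Fin (levels u) → Set (Matrix (Fin (sketchLen u n)) (Fin u) (ZMod 2) ×
      (Fin (sketchLen u n) → ZMod 2)) := fun σ i =>
    {Hφ | ε / (2 + ε) * η * n ≤ σ * (∑ k : Fin n,
      sgn ((Hφ.1.mulVec x + Hφ.2) (finProdFinEquiv (i, k))) -
        ε / (2 + ε) * n * meanSign n w x i)} with hB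
  have hB' : ∀ σ i, |σ| = 1 → π.real (B σ i) ≤ Real.exp (-(n * (ε / (2 + ε) * η) ^ 2 / 12)) := by
    intro σ i hσ
    exact ENNReal.toReal_le_of_le_ofReal (Real.exp_pos _).le
      (measure_level_ge_le hε hw x i hσ (by positivity) hδ3)
  have hsub : Gᶜ ⊆ ⋃ i ∈ (Finset.univ : Finset (Fin (levels u))), (B 1 i ∪ B (-1) i) := by
    intro Hφ hH
    simp only [G, Set.mem_compl_iff, Set.mem_ofPred_eq, not_forall, not_lt] at hH
    obtain ⟨i, hi⟩ := hH
    refine Set.mem_biUnion (Finset.mem_coe.2 (Finset.mem_univ i)) ?_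
    have hT : ∑ k : Fin n, sgn ((Hφ.1.mulVec x + Hφ.2) (finProdFinEquiv (i, k))) =
        ε / (2 + ε) * n * levelStat ε (Hφ.1.mulVec x + Hφ.2) i := by
      rw [levelStat]
      field_simp
    have hpos : 0 ≤ ε / (2 + ε) * n := by positivity
    rcases le_abs.1 hi with h | h
    · left
      have := mul_le_mul_of_nonneg_left h hpos
      simp only [hB, Set.mem_ofPred_eq, hT]
      linarith
    · right
      have := mul_le_mul_of_nonneg_left h hpos
      simp only [hB, Set.mem_ofPred_eq, hT]
      linarith
  have hc : π.real Gᶜ ≤ 2 * levels u * Real.exp (-(n * (ε / (2 + ε) * η) ^ 2 / 12)) := by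
    refine (measureReal_mono hsub (measure_ne_top _ _)).trans ((measureReal_biUnion_finset_le _ _).trans ?_)
    refine (Finset.sum_le_card_nsmul _ _
      (2 * Real.exp (-(n * (ε / (2 + ε) * η) ^ 2 / 12))) fun i _ => ?_).trans (le_of_eq ?_)
    · refine (measureReal_union_le _ _).trans ?_
      have h1 := hB' 1 i (by simp)
      have h2 := hB' (-1) i (by simp)
      linarith
    · simp
      ring
  rw [probReal_compl_eq_one_sub (Set.toFinite G).measurableSet] at hc
  linarith

/-! ### Accuracy of the estimator -/

theorem one_sub_sum_le_prod {ι : Type*} (s : Finset ι) {a : ι → ℝ} (h0 : ∀ j, 0 ≤ a j)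
    (h1 : ∀ j, a j ≤ 1) : 1 - ∑ j ∈ s, a j ≤ ∏ j ∈ s, (1 - a j) := by
  classical
  induction s using Finset.induction_on with
  | empty => simp
  | insert j s hj ih =>
    rw [Finset.sum_insert hj, Finset.prod_insert hj]
    have hp : 0 ≤ ∑ i ∈ s, a i := Finset.sum_nonneg fun i _ => h0 i
    nlinarith [mul_le_mul_of_nonneg_left ih (sub_nonneg.2 (h1 j)), mul_nonneg (h0 j) hp]

theorem abs_log_sub_log_le {s t b : ℝ} (hb : 0 < b) (hs : b ≤ s) (ht : b ≤ t) :
    |Real.log s - Real.log t| ≤ |s - t| / b := by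
  have key : ∀ {s t : ℝ}, b ≤ s → b ≤ t → Real.log s - Real.log t ≤ |s - t| / b := by
    intro s t hs ht
    have hs0 : 0 < s := hb.trans_le hs
    have ht0 : 0 < t := hb.trans_le ht
    rw [← Real.log_div hs0.ne' ht0.ne']
    calc Real.log (s / t) ≤ s / t - 1 := Real.log_le_sub_one_of_pos (by positivity)
      _ = (s - t) / t := by field_simp
      _ ≤ |s - t| / t := by gcongr; exact le_abs_self _
      _ ≤ |s - t| / b := by gcongr
  rw [abs_le]
  have h1 := key hs ht
  have h2 := key ht hs
  rw [abs_sub_comm] at h2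
  exact ⟨by linarith, h1⟩

theorem weight_eq {u : ℕ} {w : Fin u → ℝ} (hw : ∀ j, 0 < w j) (x : Fin u → ZMod 2) :
    weight w x = ∑ j, ((x j).val : ℝ) * w j :=
  Finset.sum_congr rfl fun j _ => abs_of_nonneg (mul_nonneg (Nat.cast_nonneg _) (hw j).le)

theorem val_mul_mem {u : ℕ} {w : Fin u → ℝ} (hw : ∀ j, 0 < w j ∧ w j ≤ 1) (x : Fin u → ZMod 2)
    (j : Fin u) : 0 ≤ ((x j).val : ℝ) * w j ∧ ((x j).val : ℝ) * w j ≤ 1 := by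
  have h1 : ((x j).val : ℝ) ≤ 1 := by exact_mod_cast Nat.lt_succ_iff.1 (ZMod.val_lt (x j))
  have h0 : (0 : ℝ) ≤ (x j).val := Nat.cast_nonneg _
  exact ⟨mul_nonneg h0 (hw j).1.le, mul_le_one₀ h1 (hw j).1.le (hw j).2⟩

theorem weight_le {u : ℕ} {w : Fin u → ℝ} (hw : ∀ j, 0 < w j ∧ w j ≤ 1) (x : Fin u → ZMod 2) :
    weight w x ≤ u := by
  rw [weight_eq (fun j => (hw j).1)]
  refine (Finset.sum_le_card_nsmul _ _ 1 fun j _ => (val_mul_mem hw x j).2).trans (le_of_eq ?_)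
  simp

theorem one_sub_le_meanSign {u n : ℕ} (hn : 1 ≤ n) {w : Fin u → ℝ}
    (hw : ∀ j, 0 < w j ∧ w j ≤ 1) (x : Fin u → ZMod 2) (i : ℕ) :
    1 - weight w x / (n * 2 ^ i) ≤ meanSign n w x i := by
  have hM : (1 : ℝ) ≤ n * 2 ^ i :=
    one_le_mul_of_one_le_of_one_le (by exact_mod_cast hn) (one_le_pow₀ (by norm_num))
  rw [weight_eq (fun j => (hw j).1), Finset.sum_div]
  refine one_sub_sum_le_prod _ (fun j => ?_) fun j => ?_
  · exact div_nonneg (val_mul_mem hw x j).1 (by linarith)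
  · rw [div_le_one (by linarith)]
    exact (val_mul_mem hw x j).2.trans hM

/-- Every `a j` is at most `1 / n ≤ 1 / 2`, and on this range `-log (1 - a)` lies between `a` and `a
* (1 + 2 * a)`. Summing and multiplying by `n * 2 ^ i` recovers the weight. -/
theorem log_meanSign_bounds {u n : ℕ} (hn : 2 ≤ n) {w : Fin u → ℝ}
    (hw : ∀ j, 0 < w j ∧ w j ≤ 1) (x : Fin u → ZMod 2) (i : ℕ) :
    weight w x ≤ -(n * 2 ^ i * Real.log (meanSign n w x i)) ∧
      -(n * 2 ^ i * Real.log (meanSign n w x i)) ≤ weight w x * (1 + 2 / n) := by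
  have hn2 : (2 : ℝ) ≤ n := by exact_mod_cast hn
  have hpow : (1 : ℝ) ≤ 2 ^ i := one_le_pow₀ (by norm_num)
  have hM : (n : ℝ) ≤ n * 2 ^ i := le_mul_of_one_le_right (by linarith) hpow
  set M : ℝ := n * 2 ^ i with hMdef
  have hM0 : 0 < M := by linarith
  set a : Fin u → ℝ := fun j => ((x j).val : ℝ) * w j / M with ha
  have ha0 : ∀ j, 0 ≤ a j := fun j => div_nonneg (val_mul_mem hw x j).1 hM0.le
  have han : ∀ j, a j ≤ 1 / n := fun j =>
    (div_le_div_of_nonneg_right (val_mul_mem hw x j).2 hM0.le).trans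
      (one_div_le_one_div_of_le (by linarith) hM)
  have ha2 : ∀ j, a j ≤ 1 / 2 := fun j =>
    (han j).trans (one_div_le_one_div_of_le (by norm_num) hn2)
  have hlog : Real.log (meanSign n w x i) = ∑ j, Real.log (1 - a j) :=
    Real.log_prod fun j _ => by linarith [ha2 j]
  have hW : weight w x = M * ∑ j, a j := by
    rw [weight_eq (fun j => (hw j).1), ← Finset.sum_div]
    field_simp
  have hupper : ∀ j, Real.log (1 - a j) ≤ -a j := fun j => by
    linarith [Real.log_le_sub_one_of_pos (show 0 < 1 - a j by linarith [ha2 j])]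
  have hlower : ∀ j, -(a j * (1 + 2 / n)) ≤ Real.log (1 - a j) := fun j => by
    have hpos : 0 < 1 - a j := by linarith [ha2 j]
    refine le_trans ?_ (Real.one_sub_inv_le_log_of_pos hpos)
    have h1 : a j * (1 + 2 * a j) ≤ a j * (1 + 2 / n) := by
      refine mul_le_mul_of_nonneg_left ?_ (ha0 j)
      have := han j
      rw [show (2 : ℝ) / n = 2 * (1 / n) by ring]
      linarith
    have h2 : (1 - a j)⁻¹ ≤ 1 + a j * (1 + 2 * a j) := by
      rw [inv_le_iff_one_le_mul₀ hpos]
      nlinarith [mul_nonneg (ha0 j) (mul_nonneg (ha0 j) (sub_nonneg.2 (ha2 j)))]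
    linarith
  rw [hlog, hW]
  constructor
  · have := Finset.sum_le_sum fun j (_ : j ∈ Finset.univ) => hupper j
    rw [Finset.sum_neg_distrib] at this
    nlinarith
  · have := Finset.sum_le_sum fun j (_ : j ∈ Finset.univ) => hlower j
    rw [Finset.sum_neg_distrib, ← Finset.sum_mul] at this
    have := mul_le_mul_of_nonneg_left this hM0.le
    linarith

theorem estimate_error {u n : ℕ} (hu : 2 ≤ u) {β : ℝ} (hβ : 0 < β) (hβ1 : β < 1)
    (hn : 1000 ≤ β * n) {w : Fin u → ℝ} (hw : ∀ j, 0 < w j ∧ w j ≤ 1) (x : Fin u → ZMod 2)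
    {t : Fin (levels u) → ℝ} (ht : ∀ i, |t i - meanSign n w x i| < β / 100) {v : ℝ}
    (hv : (∀ i, t i < 1 / 2) ∨ ∃ i, 1 / 2 ≤ t i ∧ (∀ i' < i, t i' < 1 / 2) ∧
      v = -(n * 2 ^ (i : ℕ) * Real.log (t i))) :
    |v - weight w x| ≤ β * weight w x + n := by
  have hL : 1 ≤ levels u := Nat.clog_pos (by norm_num) hu
  have hn1000 : (1000 : ℝ) ≤ n := hn.trans (mul_le_of_le_one_left (Nat.cast_nonneg _) hβ1.le)
  have hn2 : 2 ≤ n := by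
    have : (2 : ℝ) ≤ n := by linarith
    exact_mod_cast this
  have hn0 : (0 : ℝ) < n := by linarith
  have hW0 : 0 ≤ weight w x := Finset.sum_nonneg fun j _ => abs_nonneg _
  rcases hv with hv | ⟨i, hi, hlt, rfl⟩
  -- At the last level `2 ^ (levels u - 1)` is at least `u / 2`, and the weight is at most `u`. The
  -- mean is therefore close to `1` and the statistic exceeds `1 / 2`.
  · exfalso
    have h1 := hv ⟨levels u - 1, by omega⟩
    have h2 := (abs_lt.1 (ht ⟨levels u - 1, by omega⟩)).1
    have h3 := one_sub_le_meanSign (n := n) (by omega) hw x (levels u - 1)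
    have h4 : (u : ℝ) ≤ 2 * 2 ^ (levels u - 1) := by
      rw [← pow_succ', Nat.sub_add_cancel hL]
      exact_mod_cast Nat.le_pow_clog (by norm_num) u
    have h5 : weight w x / (n * 2 ^ (levels u - 1)) ≤ 1 / 100 := by
      rw [div_le_iff₀ (by positivity)]
      have := weight_le hw x
      have hp : (0 : ℝ) < 2 ^ (levels u - 1) := by positivity
      nlinarith
    dsimp only at *
    linarith
  · obtain ⟨hlo, hhi⟩ := log_meanSign_bounds hn2 hw x i
    have hq := abs_lt.1 (ht i)
    -- The statistic is at least `1 / 2` and its error is below `1 / 100`, so both arguments are at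
    -- least `49 / 100`. The error `β / 100` thus becomes `β / 49` in the logarithm.
    have hlog := abs_log_sub_log_le (b := 49 / 100) (by norm_num)
      (show 49 / 100 ≤ t i by linarith) (show 49 / 100 ≤ meanSign n w x i by linarith)
    have hlog' : |Real.log (t i) - Real.log (meanSign n w x i)| ≤ β / 49 :=
      hlog.trans (by rw [div_le_iff₀ (by norm_num)]; linarith [ht i])
    have hrel : weight w x * (2 / n) ≤ weight w x * (β / 500) := by
      refine mul_le_mul_of_nonneg_left ?_ hW0
      rw [div_le_iff₀ hn0]
      linarith
    set M : ℝ := n * 2 ^ (i : ℕ) with hM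
    have hM0 : 0 < M := by positivity
    -- At level `0`, `M = n` and the additive term suffices. Otherwise the preceding mean is below
    -- `51 / 100`, so the weight is at least `49 / 100 * (M / 2)` and the error is relative.
    have hsmall : M * (β / 49) ≤ β / 2 * weight w x + n := by
      by_cases hi0 : (i : ℕ) = 0
      · rw [hM, hi0, pow_zero, mul_one]
        nlinarith [mul_nonneg hβ.le hW0]
      · have hprev := hlt ⟨i - 1, by omega⟩ (Fin.lt_def.2 (by simp; omega))
        have h2 := (abs_lt.1 (ht ⟨i - 1, by omega⟩)).1
        have h3 := one_sub_le_meanSign (n := n) (by omega) hw x (i - 1)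
        have hMM : M = 2 * (n * 2 ^ ((i : ℕ) - 1)) := by
          rw [hM]
          nth_rw 1 [← Nat.sub_add_cancel (Nat.one_le_iff_ne_zero.2 hi0)]
          rw [pow_succ]
          ring
        have h4 : 49 / 100 ≤ weight w x / (n * 2 ^ ((i : ℕ) - 1)) := by
          dsimp only at *
          linarith
        rw [le_div_iff₀ (by positivity)] at h4
        nlinarith
    have hdiff : |M * (Real.log (t i) - Real.log (meanSign n w x i))| ≤ M * (β / 49) := by
      rw [abs_mul, abs_of_pos hM0]
      exact mul_le_mul_of_nonneg_left hlog' hM0.le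
    have hd := abs_le.1 hdiff
    rw [abs_le]
    constructor <;> nlinarith [mul_nonneg hβ.le hW0]

end NoisyKOR

/-! ### Choice of the sketch size and the constants -/

theorem theorem1 (E : ℝ) (hE : 0 < E) :
    ∃ C : ℝ, 0 < C ∧ ∃ P Q : NoisyKOR.Program,
      ∀ (u : ℕ) (ε β : ℝ), 2 ≤ u → 0 < ε → ε ≤ E → 0 < β → β < 1 →
        ∃ n : ℕ, 1 ≤ n ∧
          (NoisyKOR.sketchLen u n : ℝ) ≤ C * (Real.log u ^ 2 * (ε ^ 2)⁻¹ * (β ^ 2)⁻¹) ∧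
          (∃ est : (Fin (NoisyKOR.sketchLen u n) → ZMod 2) → ℝ,
            (∀ y, NoisyKOR.Estimates P u n ε β y (C * NoisyKOR.sketchLen u n) (est y)) ∧
            ∀ w : Fin u → ℝ, (∀ j, 0 < w j ∧ w j ≤ 1) → ∀ x : Fin u → ZMod 2,
              1 - 1 / (u : ℝ) ≤
                ((NoisyKOR.sketchDist n w).prod
                    (NoisyKOR.noiseDist (NoisyKOR.sketchLen u n) ε)).real
                  {Hφ | |est (Hφ.1.mulVec x + Hφ.2) - NoisyKOR.weight w x| <
                    β * NoisyKOR.weight w x + C * (Real.log u * (ε ^ 2)⁻¹ * (β ^ 2)⁻¹)}) ∧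
          ∀ w : Fin u → ℝ, (∀ j, 0 < w j ∧ w j ≤ 1) →
            ∀ (h : Fin u → Fin n) (s : Fin u → unitInterval),
              NoisyKOR.IsDP (fun x x' : Fin u → ZMod 2 => hammingDist x x' = 1) ε
                (fun x => (NoisyKOR.noiseDist (NoisyKOR.sketchLen u n) ε).map
                  fun φ => (NoisyKOR.sketch w h s).mulVec x + φ) ∧
              ∀ (x : Fin u → ZMod 2) (l : List (Fin u)), l.Nodup → (∀ j, j ∈ l ↔ x j ≠ 0) →
                ∃ Y : (ℕ → unitInterval) → (Fin (NoisyKOR.sketchLen u n) → ZMod 2),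
                  Measurable Y ∧
                  (∀ ω, NoisyKOR.Sketches Q ε β w h s l ω
                    (C * ((hammingNorm x : ℝ) * Real.log u + NoisyKOR.sketchLen u n)) (Y ω)) ∧
                  NoisyKOR.coinDist.map Y =
                    (NoisyKOR.noiseDist (NoisyKOR.sketchLen u n) ε).map
                      fun φ => (NoisyKOR.sketch w h s).mulVec x + φ := by
  -- Here `360000 = 3 * 12 * 100 ^ 2`: the accuracy is `β / 100`, the Chernoff exponent has
  -- denominator `12`, and the target exponent is `3 * log u`. The factor `(2 + E) ^ 2` bounds `(2 +
  -- ε) ^ 2`.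
  set K : ℝ := 360000 * (2 + E) ^ 2 with hK
  set C₁ : ℝ := K + 2 * E ^ 2 with hC₁
  have hK0 : 0 < K := by positivity
  have hC₁0 : 0 < C₁ := by positivity
  -- `3 * C₁` covers the sketch length, with `3` from `levels_le`; `57` is the step constant of the
  -- sketching program.
  refine ⟨3 * C₁ + 57, by positivity, NoisyKOR.estimator, NoisyKOR.sketcher, ?_⟩
  intro u ε β hu hε hεE hβ hβ1
  set X : ℝ := Real.log u * (ε ^ 2)⁻¹ * (β ^ 2)⁻¹ with hX
  have hlog : 1 / 2 ≤ Real.log u := by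
    have h1 : Real.log 2 ≤ Real.log u := Real.log_le_log (by norm_num) (by exact_mod_cast hu)
    linarith [Real.log_two_gt_d9]
  have hX0 : 0 < X := by positivity
  have hXlog : X * (ε ^ 2 * β ^ 2) = Real.log u := by
    rw [hX]
    field_simp
  set n := ⌈K * X⌉₊ with hn
  have hnK : K * X ≤ n := Nat.le_ceil _
  -- Since `ε` is bounded by `E`, `X` is bounded below, and the `+ 1` of rounding up is absorbed
  -- into `C₁ * X`.
  have hEX : 1 ≤ 2 * E ^ 2 * X := by
    have h1 : ε ^ 2 * β ^ 2 ≤ E ^ 2 := by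
      have := pow_le_pow_left₀ hε.le hεE 2
      have := pow_le_one₀ (n := 2) hβ.le hβ1.le
      nlinarith [sq_nonneg ε]
    nlinarith
  have hnC : (n : ℝ) ≤ C₁ * X := by
    have := Nat.ceil_lt_add_one (a := K * X) (by positivity)
    rw [hC₁, add_mul]
    linarith
  have hn1 : 1 ≤ n := Nat.ceil_pos.2 (by positivity)
  have : NeZero n := ⟨by omega⟩
  have hτ0 : (0 : ℝ) ≤ NoisyKOR.sketchLen u n := Nat.cast_nonneg _
  refine ⟨n, hn1, ?_, ?_, ?_⟩
  · have h1 : Real.log u ^ 2 * (ε ^ 2)⁻¹ * (β ^ 2)⁻¹ = Real.log u * X := by rw [hX]; ring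
    rw [h1]
    push_cast
    calc (NoisyKOR.levels u : ℝ) * n ≤ 3 * Real.log u * (C₁ * X) :=
          mul_le_mul (NoisyKOR.levels_le hu) hnC (Nat.cast_nonneg _) (by positivity)
      _ ≤ (3 * C₁ + 57) * (Real.log u * X) := by
          have : 0 ≤ Real.log u * X := by positivity
          linarith
  · choose est hest hspec using fun y => NoisyKOR.estimator_spec (n := n) ε β hu hn1 y
      (show 33 ≤ 3 * C₁ + 57 by linarith)
    refine ⟨est, hest, fun w hw x => ?_⟩
    have hconc := NoisyKOR.levelStat_concentration (n := n) hε hw x (η := β / 100) (by positivity)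
      (by linarith)
    have hexp : 3 * Real.log u ≤ n * (ε / (2 + ε) * (β / 100)) ^ 2 / 12 := by
      have h1 : (ε / (2 + E)) ≤ ε / (2 + ε) := by gcongr
      have h2 : (ε / (2 + E) * (β / 100)) ^ 2 ≤ (ε / (2 + ε) * (β / 100)) ^ 2 := by gcongr
      have h3 : K * X * (ε / (2 + E) * (β / 100)) ^ 2 = 36 * Real.log u := by
        rw [← hXlog, hK]
        field_simp
        ring
      have h4 : K * X * (ε / (2 + E) * (β / 100)) ^ 2 ≤ n * (ε / (2 + ε) * (β / 100)) ^ 2 :=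
        mul_le_mul hnK h2 (sq_nonneg _) (Nat.cast_nonneg _)
      linarith
    have hnβ : 1000 ≤ β * n := by
      have h1 : ε ^ 2 ≤ (2 + E) ^ 2 := by gcongr; linarith
      have h2 : K * X * (ε ^ 2 * β ^ 2) = 360000 * (2 + E) ^ 2 * Real.log u := by
        rw [mul_assoc, hXlog]
      have h3 : 180000 * ε ^ 2 ≤ n * (ε ^ 2 * β ^ 2) := by
        have := mul_le_mul_of_nonneg_right hnK (by positivity : 0 ≤ ε ^ 2 * β ^ 2)
        rw [h2] at this
        nlinarith [sq_nonneg ε]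
      have h4 : 180000 ≤ n * β ^ 2 := by
        have hε2 : 0 < ε ^ 2 := by positivity
        by_contra hcon
        push Not at hcon
        nlinarith
      have h5 : n * β ^ 2 ≤ β * n := by
        have : 0 ≤ β * n := by positivity
        nlinarith
      linarith
    have hprob : 2 * (NoisyKOR.levels u : ℝ) *
        Real.exp (-(n * (ε / (2 + ε) * (β / 100)) ^ 2 / 12)) ≤ 1 / u := by
      have hu0 : (0 : ℝ) < u := by positivity
      -- The union bound costs at most `u ^ 2`, which leaves `1 / u` of the factor `u ^ (-3)` from
      -- the exponential.
      have hlev : 2 * NoisyKOR.levels u ≤ u * u := by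
        have h1 : 2 ^ (NoisyKOR.levels u - 1) < u :=
          Nat.pow_pred_clog_lt_self (by norm_num) hu
        have h2 : NoisyKOR.levels u - 1 < 2 ^ (NoisyKOR.levels u - 1) := Nat.lt_two_pow_self
        have h3 : NoisyKOR.levels u ≤ u := by omega
        nlinarith
      have hlevR : 2 * (NoisyKOR.levels u : ℝ) ≤ u * u := by exact_mod_cast hlev
      have he : Real.exp (-(n * (ε / (2 + ε) * (β / 100)) ^ 2 / 12)) ≤ ((u : ℝ) ^ 3)⁻¹ := by
        have : ((u : ℝ) ^ 3)⁻¹ = Real.exp (-(3 * Real.log u)) := by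
          rw [Real.exp_neg, mul_comm, Real.exp_mul, Real.exp_log hu0]
          norm_cast
        rw [this]
        exact Real.exp_le_exp.2 (neg_le_neg hexp)
      calc _ ≤ (u * u : ℝ) * ((u : ℝ) ^ 3)⁻¹ :=
            mul_le_mul hlevR he (Real.exp_pos _).le (by positivity)
        _ = 1 / u := by field_simp
    refine (sub_le_sub_left hprob 1).trans (hconc.trans (measureReal_mono ?_ (measure_ne_top _ _)))
    intro Hφ hH
    have herr := NoisyKOR.estimate_error hu hβ hβ1 hnβ hw x hH (hspec (Hφ.1.mulVec x + Hφ.2))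
    refine lt_of_le_of_lt herr ?_
    -- The error bound so far is non-strict; strictness comes from `n ≤ C₁ * X < (3 * C₁ + 57) * X`.
    have : 0 < C₁ * X := by positivity
    linarith
  · intro w hw h s
    refine ⟨NoisyKOR.isDP_sketch hε (fun j => (hw j).1) h s, fun x l hl hx => ?_⟩
    exact NoisyKOR.sketcher_correct β hu hn1 hε (fun j => (hw j).1) h s hl hx (by linarith)
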